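/- Let $m_0:\mathbb T\to\mathbb C$ be a measurable function on the unit circle with $m_0(1)=\sqrt2$ and $|m_0(z)|^2+|m_0(-z)|^2=2$ for all $z\in\mathbb T$, and put $m_1(z)=z\,\overline{m_0(-z)}$. On $L^2(\mathbb T)$ (normalized Haar measure) let $(S_if)(z)=m_i(z)f(z^2)$ for $i=0,1$, and let $e_k(z)=z^k$ for $k\in\mathbb Z$. Let $\varphi_0,\varphi_1,\varphi_2,\dots\in L^2(\mathbb R)$ satisfy, for all $n\ge 0$ and almost every $x\in\mathbb R$, $$\widehat{\varphi_{2n}}(x)=\tfrac1{\sqrt2}\,m_0\big(e^{-2\pi i x/2}\big)\,\widehat{\varphi_n}(x/2),\qquad \widehat{\varphi_{2n+1}}(x)=\tfrac1{\sqrt2}\,m_1\big(e^{-2\pi i x/2}\big)\,\widehat{\varphi_n}(x/2),$$ where $\widehat f(x)=\int_{\mathbb R} e^{-2\pi i x t}f(t)\,dt$ (extended to $L^2(\mathbb R)$), and suppose that $\{\varphi_m(\cdot-j)\mid m\in\mathbb N_0,\ j\in\mathbb Z\}$ is an orthonormal basis of $L^2(\mathbb R)$. For a unit vector $f\in L^2(\mathbb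 R)$ put $P_f(m,j)=|\langle\varphi_m(\cdot-j)\mid f\rangle|^2$ for $(m,j)\in\mathbb N_0\times\mathbb Z$. There is a projection-valued Borel measure $E$ on $[0,1]$ with $$E\Big(\big[\tfrac{i_1}2+\cdots+\tfrac{i_p}{2^p},\ \tfrac{i_1}2+\cdots+\tfrac{i_p}{2^p}+\tfrac1{2^p}\big)\Big)=S_{i_1}\cdots S_{i_p}S_{i_p}^*\cdots S_{i_1}^*$$ for all $p\ge0$ and $i_1,\dots,i_p\in\{0,1\}$ (this determines $E$). Write $\mu_g(B)=\|E(B)g\|^2$ for $g\in L^2(\mathbb T)$. Then, for all $p,n\in\mathbb N_0$ and $k\in\mathbb Z$, with $f=2^{p/2}\varphi_n(2^p\cdot-k)$, the function $P_f$ is a probability distribution on $\mathbb N_0\times\mathbb Z$, and its marginal in the first variable is as follows. For all $i_1,\dots,i_p\in\{0,1\}$, at $m=2^pn+i_12^{p-1}+i_22^{p-2}+\cdots+i_p$, $$\sum_{j\in\mathbb Z}P_f(m,j)=\mu_{e_k}\Big(\big[\tfrac{i_1}2+\cdots+\tfrac{i_p}{2^p},\ \tfrac{i_1}2+\cdots+\tfrac{i_p}{2^p}+\tfrac1{2^p}\big)\Big),$$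 and $\sum_{j\in\mathbb Z}P_f(m,j)=0$ for every $m\in\mathbb N_0$ that is not of this form. -/

import Mathlib

open MeasureTheory Set
open scoped ENNReal FourierTransform InnerProductSpace

noncomputable section

namespace WaveletPackets

/-! ## The Hilbert space of the circle and the two operators of a quadrature mirror filter -/

instance instMeasurableSpaceCircle : MeasurableSpace Circle := borel Circle

instance instBorelSpaceCircle : BorelSpace Circle := ⟨rfl⟩

/-- `L²(𝕋)` for the normalized Haar measure; the point of `𝕋` with coordinate `x ∈ ℝ/ℤ` is
`z = exp (2 π i x)`, i.e. `AddCircle.toCircle x`. -/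
abbrev L2T : Type := Lp ℂ 2 (AddCircle.haarAddCircle : Measure UnitAddCircle)

/-- The standard basis `e_k(z) = z ^ k` of `L²(𝕋)`. -/
def e (k : ℤ) : L2T := fourierLp 2 k

/-- The map `z ↦ z ^ 2` preserves Haar measure. -/
theorem measurePreserving_double :
    MeasurePreserving (fun x : UnitAddCircle => (2 : ℕ) • x)
      AddCircle.haarAddCircle AddCircle.haarAddCircle := by
  have h := ((nsmulAddMonoidHom (α := UnitAddCircle) 2)).measurePreserving
    (μ := AddCircle.haarAddCircle) (ν := AddCircle.haarAddCircle)
    (by exact continuous_nsmul 2)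
    (by
      intro y
      obtain ⟨t, rfl⟩ := QuotientAddGroup.mk_surjective y
      refine ⟨((t / 2 : ℝ) : UnitAddCircle), ?_⟩
      change (2 : ℕ) • ((t / 2 : ℝ) : UnitAddCircle) = ((t : ℝ) : UnitAddCircle)
      rw [← AddCircle.coe_nsmul]
      congr 1
      simp [nsmul_eq_mul]
      ring)
    (by simp)
  exact h

/-- A bounded measurable function on `𝕋`, as an element of `L^∞(𝕋)`. -/
def symbol (m : Circle → ℂ) (hm : Measurable m) (C : ℝ) (hC : ∀ z, ‖m z‖ ≤ C) :
    Lp ℂ ∞ (AddCircle.haarAddCircle : Measure UnitAddCircle) :=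
  MemLp.toLp (fun x : UnitAddCircle => m (AddCircle.toCircle x))
    (memLp_top_of_bound
      ((hm.comp AddCircle.continuous_toCircle.measurable).aestronglyMeasurable) C
      (Filter.Eventually.of_forall fun _ => hC _))

/-- The bounded operator `(S f)(z) = m(z) f(z²)` on `L²(𝕋)`; see `filterOp_apply`. -/
def filterOp (m : Circle → ℂ) (hm : Measurable m) (C : ℝ) (hC : ∀ z, ‖m z‖ ≤ C) :
    L2T →L[ℂ] L2T :=
  ((ContinuousLinearMap.mul ℂ ℂ).holderL AddCircle.haarAddCircle ∞ 2 2 (symbol m hm C hC)).comp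
    (Lp.compMeasurePreservingₗᵢ ℂ _ measurePreserving_double).toContinuousLinearMap

theorem filterOp_apply (m : Circle → ℂ) (hm : Measurable m) (C : ℝ) (hC : ∀ z, ‖m z‖ ≤ C)
    (f : L2T) :
    filterOp m hm C hC f =ᵐ[AddCircle.haarAddCircle]
      fun x => m (AddCircle.toCircle x) * f ((2 : ℕ) • x) := by
  have h1 : (filterOp m hm C hC f : UnitAddCircle → ℂ) =ᵐ[AddCircle.haarAddCircle] _ :=
    (ContinuousLinearMap.mul ℂ ℂ).coeFn_holder (r := 2) (symbol m hm C hC)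
      (Lp.compMeasurePreserving _ measurePreserving_double f)
  have h2 : (symbol m hm C hC : UnitAddCircle → ℂ) =ᵐ[AddCircle.haarAddCircle] _ :=
    MemLp.coeFn_toLp _
  have h3 := Lp.coeFn_compMeasurePreserving f measurePreserving_double
  filter_upwards [h1, h2, h3] with x a b c
  rw [a, b, c]
  rfl

/-- A quadrature mirror filter with the low-pass normalization:
a measurable `m₀ : 𝕋 → ℂ` with `m₀(1) = √2` and `|m₀(z)|² + |m₀(-z)|² = 2`. -/
structure QMF where
  /-- the low-pass function `m₀` -/
  low : Circle → ℂ
  measurable_low : Measurable low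
  low_one : low 1 = (√2 : ℝ)
  norm_sq_add : ∀ z : Circle, ‖low z‖ ^ 2 + ‖low (-z)‖ ^ 2 = 2

namespace QMF

variable (m : QMF)

/-- The high-pass function `m₁(z) = z * conj (m₀(-z))`. -/
def high (z : Circle) : ℂ := z * (starRingEnd ℂ) (m.low (-z))

theorem norm_low_le (z : Circle) : ‖m.low z‖ ≤ √2 :=
  Real.le_sqrt_of_sq_le (by nlinarith [m.norm_sq_add z, sq_nonneg ‖m.low (-z)‖])

theorem measurable_high : Measurable m.high := by
  have h : Measurable fun z : Circle => m.low (-z) :=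
    m.measurable_low.comp continuous_neg.measurable
  exact (by fun_prop : Continuous fun z : Circle => (z : ℂ)).measurable.mul
    (Complex.continuous_conj.measurable.comp h)

theorem norm_high_le (z : Circle) : ‖m.high z‖ ≤ √2 := by
  have h : ‖m.high z‖ = ‖m.low (-z)‖ := by
    rw [high, norm_mul, Circle.norm_coe, one_mul, RCLike.norm_conj]
  exact h ▸ m.norm_low_le (-z)

/-- The operators `(S_i f)(z) = m_i(z) f(z²)`, `i = 0, 1`. -/
def S : Fin 2 → (L2T →L[ℂ] L2T) :=
  ![filterOp m.low m.measurable_low (√2) m.norm_low_le,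
    filterOp m.high m.measurable_high (√2) m.norm_high_le]

end QMF

/-! ## The projection-valued measure on `[0, 1]` and the scalar measures `μ_f` -/

/-- Projection-valued measures: every measurable set is sent to an orthogonal projection,
the whole space to the identity, and `E` is countably additive in the strong operator topology.
(Values on non-measurable sets are irrelevant.) -/
structure IsProjectionValuedMeasure {X : Type*} [MeasurableSpace X] {H : Type*}
    [NormedAddCommGroup H] [InnerProductSpace ℂ H] [CompleteSpace H]
    (E : Set X → (H →L[ℂ] H)) : Prop where
  isStarProjection : ∀ B, MeasurableSet B → IsStarProjection (E B)
  univ : E Set.univ = 1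
  hasSum : ∀ B : ℕ → Set X, (∀ n, MeasurableSet (B n)) →
    Pairwise (fun a b => Disjoint (B a) (B b)) →
    ∀ f : H, HasSum (fun n => E (B n) f) (E (⋃ n, B n) f)

/-- The left endpoint `i_1/2 + ⋯ + i_p/2^p`; the digit `i_l` is `i (l - 1)`. -/
def dyadicPoint {p : ℕ} (i : Fin p → Fin 2) : ℝ :=
  ∑ l : Fin p, ((i l : ℕ) : ℝ) / 2 ^ ((l : ℕ) + 1)

/-- The dyadic interval `[i_1/2 + ⋯ + i_p/2^p, i_1/2 + ⋯ + i_p/2^p + 1/2^p)` in `[0, 1]`. -/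
def dyadicInterval {p : ℕ} (i : Fin p → Fin 2) : Set unitInterval :=
  {x | dyadicPoint i ≤ (x : ℝ) ∧ (x : ℝ) < dyadicPoint i + 1 / 2 ^ p}

section Cuntz

variable {H : Type*} [NormedAddCommGroup H] [InnerProductSpace ℂ H] [CompleteSpace H]

/-- The product `S_{i_1} ⋯ S_{i_p}`. -/
def word (S : Fin 2 → (H →L[ℂ] H)) {p : ℕ} (i : Fin p → Fin 2) : H →L[ℂ] H :=
  (List.ofFn fun l => S (i l)).prod

/-- `E` is a projection-valued Borel measure on `[0, 1]` which takes the value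
`S_{i_1} ⋯ S_{i_p} S_{i_p}^* ⋯ S_{i_1}^*` on the dyadic interval with digits `i_1, …, i_p`. -/
structure IsDyadicSpectralMeasure (S : Fin 2 → (H →L[ℂ] H))
    (E : Set unitInterval → (H →L[ℂ] H)) : Prop where
  isProjectionValuedMeasure : IsProjectionValuedMeasure E
  apply_dyadicInterval : ∀ (p : ℕ) (i : Fin p → Fin 2),
    E (dyadicInterval i) = word S i * ContinuousLinearMap.adjoint (word S i)

open Classical in
/-- The projection-valued measure `E` of the pair `S_0, S_1` (it is determined on all Borel sets
by its defining property; the value is `0` if there is no such measure). -/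
def spectralMeasure (S : Fin 2 → (H →L[ℂ] H)) : Set unitInterval → (H →L[ℂ] H) :=
  if h : ∃ E, IsDyadicSpectralMeasure S E then h.choose else 0

/-- The scalar measure `μ_f(B) = ‖E(B) f‖²`. -/
def scalarMeasure (S : Fin 2 → (H →L[ℂ] H)) (f : H) (B : Set unitInterval) : ℝ :=
  ‖spectralMeasure S B f‖ ^ 2

end Cuntz

/-! ## Wavelet packets in `L²(ℝ)` -/

/-- `L²(ℝ)` for Lebesgue measure. -/
abbrev L2R : Type := Lp ℂ 2 (volume : Measure ℝ)

/-- The translate `f(· - j)`. -/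
def translate (j : ℤ) (f : L2R) : L2R :=
  Lp.compMeasurePreserving (fun t : ℝ => t - (j : ℝ)) (measurePreserving_sub_right volume (j : ℝ)) f

theorem memLp_packet (p : ℕ) (k : ℤ) (f : L2R) :
    MemLp (fun t : ℝ => (((2 : ℝ) ^ ((p : ℝ) / 2) : ℝ) : ℂ) * f (2 ^ p * t - k)) 2 volume := by
  have h2 : (2 : ℝ) ^ p ≠ 0 := by positivity
  have hf : MemLp (fun t : ℝ => f (t - k)) 2 volume :=
    (Lp.memLp f).comp_measurePreserving (measurePreserving_sub_right volume (k : ℝ))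
  have hg : MemLp (fun t : ℝ => f (2 ^ p * t - k)) 2 volume := by
    have hmap : Measure.map (fun t : ℝ => 2 ^ p * t) volume
        = ENNReal.ofReal |((2 : ℝ) ^ p)⁻¹| • volume := Real.map_volume_mul_left h2
    have hf' : MemLp (fun t : ℝ => f (t - k)) 2
        (Measure.map (fun t : ℝ => 2 ^ p * t) volume) := by
      rw [hmap]
      exact hf.smul_measure ENNReal.ofReal_ne_top
    exact hf'.comp_of_map (measurable_const_mul _).aemeasurable
  exact hg.const_mul _

/-- The function `2^{p/2} f(2^p t - k)`. -/
def packet (p : ℕ) (k : ℤ) (f : L2R) : L2R :=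
  (memLp_packet p k f).toLp _

/-- `φ_0, φ_1, …` are the wavelet packet functions of the filter: with `f̂ = 𝓕 f`
(`f̂(x) = ∫ exp (-2 π i x t) f(t) dt`) and `m_j(x) = m_j(exp (-2 π i x))`,
`φ̂_{2n}(x) = 2^{-1/2} m_0(x/2) φ̂_n(x/2)` and `φ̂_{2n+1}(x) = 2^{-1/2} m_1(x/2) φ̂_n(x/2)`. -/
structure IsPacketSequence (m : QMF) (φ : ℕ → L2R) : Prop where
  even : ∀ n, (𝓕 (φ (2 * n)) : L2R) =ᵐ[volume] fun x : ℝ =>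
    (((√2)⁻¹ : ℝ) : ℂ) * m.low (Circle.exp (-(2 * Real.pi * (x / 2)))) * (𝓕 (φ n) : L2R) (x / 2)
  odd : ∀ n, (𝓕 (φ (2 * n + 1)) : L2R) =ᵐ[volume] fun x : ℝ =>
    (((√2)⁻¹ : ℝ) : ℂ) * m.high (Circle.exp (-(2 * Real.pi * (x / 2)))) * (𝓕 (φ n) : L2R) (x / 2)

/-- The functions `φ_n(· - j)`, `n ∈ ℕ`, `j ∈ ℤ`, form an orthonormal basis of `L²(ℝ)`. -/
structure IsTranslateBasis (φ : ℕ → L2R) : Prop where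
  orthonormal : Orthonormal ℂ fun q : ℕ × ℤ => translate q.2 (φ q.1)
  total : (Submodule.span ℂ
    (Set.range fun q : ℕ × ℤ => translate q.2 (φ q.1))).topologicalClosure = ⊤

/-- `P_f(m, j) = |⟨φ_m(· - j) | f⟩|²`. -/
def packetDistribution (φ : ℕ → L2R) (f : L2R) (q : ℕ × ℤ) : ℝ :=
  ‖⟪translate q.2 (φ q.1), f⟫_ℂ‖ ^ 2

/-- The frequency index `2^p n + i_1 2^{p-1} + i_2 2^{p-2} + ⋯ + i_p`;
the digit `i_l` is `i (l - 1)`. -/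
def frequencyIndex (n : ℕ) {p : ℕ} (i : Fin p → Fin 2) : ℕ :=
  2 ^ p * n + ∑ l : Fin p, (i l : ℕ) * 2 ^ (p - 1 - (l : ℕ))

end WaveletPackets

end

/-! Let `W_r : L²(𝕋) → L²(ℝ)` be the isometry `e_j ↦ φ_r(· - j)` (`packetSynthesis`) and `U` the
dilation `(U f)(t) = √2 f(2t)`. On the Fourier side the packet equations say `W_{2n+i} = U W_n S_i`,
while `2^{p/2} φ_n(2^p · - k) = U^p W_n e_k`. Since `U` is an isometry, each pairing of `W_r g` with
this vector strips one binary digit of `r` and one factor `U`. After `p` steps the orthogonality of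
the ranges of the `W_s` leaves `⟨S_{i_1} ⋯ S_{i_p} g, e_k⟩` if `r` has the stated form, and `0`
otherwise (`inner_packetSynthesis_packet`). Parseval in `g = e_j` gives the marginal `‖S_{i_p}^* ⋯
S_{i_1}^* e_k‖²`, which is `μ_{e_k}` of the dyadic interval because words in the `S_i` are
isometries.

The harder half is the existence of `E`. The same factorization gives the Cuntz relations:
orthonormality makes `S_0, S_1` isometries with orthogonal ranges, and totality makes the ranges
span. The numbers `‖S_{i_p}^* ⋯ S_{i_1}^* f‖²` are then additive on the dyadic tree. They extend to
a measure on half-open intervals only if no mass escapes to a right endpoint, that is, if `S_1^{*r}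
→ 0` strongly.

That holds because `S_1` has no unitary part. Mixing of `z ↦ z²` shows that a nonzero vector in the
range of every `S_1^p` forces `|m_1| = 1` a.e., hence `|m_0| = 1` a.e. Then `|φ̂_0(x)|² =
|φ̂_0(x/2)|² / 2`, so `φ̂_0` puts all its mass at the origin and vanishes, contradicting `‖φ_0‖ =
1`. -/

namespace WaveletPackets

open Filter Topology

/-! ### Orthogonal projections and projection-valued measures from scalar measures -/

section Projections

variable {H : Type*} [NormedAddCommGroup H] [InnerProductSpace ℂ H] [CompleteSpace H]

theorem isStarProjection_inner_left {P : H →L[ℂ] H} (hP : IsStarProjection P) (f g : H) :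
    ⟪P f, g⟫_ℂ = ⟪f, P g⟫_ℂ := by
  have h := hP.isSelfAdjoint
  rw [ContinuousLinearMap.isSelfAdjoint_iff'] at h
  rw [← ContinuousLinearMap.adjoint_inner_right, h]

theorem isStarProjection_apply_apply {P : H →L[ℂ] H} (hP : IsStarProjection P) (f : H) :
    P (P f) = P f :=
  congrArg (fun T : H →L[ℂ] H => T f) hP.isIdempotentElem.eq

theorem isStarProjection_inner_self {P : H →L[ℂ] H} (hP : IsStarProjection P) (f : H) :
    ⟪P f, f⟫_ℂ = ((‖P f‖ ^ 2 : ℝ) : ℂ) := by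
  rw [← isStarProjection_apply_apply hP f, isStarProjection_inner_left hP,
    inner_self_eq_norm_sq_to_K, isStarProjection_apply_apply hP f]
  simp

/-- For a projection `‖P f‖² = ⟨P f, f⟩`, and over `ℂ` the quadratic form determines the operator.
This identifies `E B` from scalar data alone. -/
theorem isStarProjection_ext {P Q : H →L[ℂ] H} (hP : IsStarProjection P) (hQ : IsStarProjection Q)
    (h : ∀ f, ‖P f‖ ^ 2 = ‖Q f‖ ^ 2) : P = Q := by
  have := (ext_inner_map (P : H →ₗ[ℂ] H) (Q : H →ₗ[ℂ] H)).1 fun x => by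
    simp only [ContinuousLinearMap.coe_coe]
    rw [isStarProjection_inner_self hP, isStarProjection_inner_self hQ, h]
  exact ContinuousLinearMap.coe_injective this

theorem isStarProjection_of_inner {Q : H →L[ℂ] H} (h1 : ∀ f, Q (Q f) = Q f)
    (h2 : ∀ f g, ⟪Q f, g⟫_ℂ = ⟪f, Q g⟫_ℂ) : IsStarProjection Q := by
  refine ⟨ContinuousLinearMap.ext h1, ?_⟩
  rw [ContinuousLinearMap.isSelfAdjoint_iff_isSymmetric]
  exact h2

theorem norm_sq_one_sub_apply {P : H →L[ℂ] H} (hP : IsStarProjection P) (f : H) :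
    ‖(1 - P) f‖ ^ 2 = ‖f‖ ^ 2 - ‖P f‖ ^ 2 := by
  have h := isStarProjection_inner_self hP f
  have h1 := @norm_sub_sq ℂ H _ _ _ f (P f)
  rw [← inner_conj_symm, h] at h1
  simp only [sub_apply, one_apply_eq_self, h1]
  have : RCLike.re ((starRingEnd ℂ) ((‖P f‖ ^ 2 : ℝ) : ℂ)) = ‖P f‖ ^ 2 := by
    rw [Complex.conj_ofReal]; exact Complex.ofReal_re _
  rw [this]; ring

/-- On `P f` the projection `P` already uses up the whole norm, so nothing is left for `Q`. -/
theorem comp_eq_zero_of_norm_sq_add_le {P Q : H →L[ℂ] H} (hP : IsStarProjection P)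
    (h : ∀ f, ‖P f‖ ^ 2 + ‖Q f‖ ^ 2 ≤ ‖f‖ ^ 2) (f : H) : Q (P f) = 0 := by
  have := h (P f)
  rw [isStarProjection_apply_apply hP f] at this
  have h2 : ‖Q (P f)‖ ^ 2 ≤ 0 := by linarith
  exact norm_eq_zero.1 (pow_eq_zero_iff two_ne_zero |>.1 (le_antisymm h2 (sq_nonneg _)))

/-- A sequence of projections whose squared norms sum up to at most `‖f‖ ^ 2` is orthogonal, and
its strong sum is a projection. -/
theorem exists_isStarProjection_hasSum {P : ℕ → H →L[ℂ] H} (hP : ∀ n, IsStarProjection (P n))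
    {s : H → ℝ} (hs : ∀ f, HasSum (fun n => ‖P n f‖ ^ 2) (s f)) (hle : ∀ f, s f ≤ ‖f‖ ^ 2) :
    ∃ Q : H →L[ℂ] H, IsStarProjection Q ∧ (∀ f, HasSum (fun n => P n f) (Q f)) ∧
      ∀ f, ‖Q f‖ ^ 2 = s f := by
  have horth : ∀ a b, a ≠ b → ∀ f, P b (P a f) = 0 := fun a b hab f => by
    refine comp_eq_zero_of_norm_sq_add_le (hP a) (fun f => ?_) f
    rw [← Finset.sum_pair (f := fun n => ‖P n f‖ ^ 2) hab]
    exact (sum_le_hasSum _ (fun _ _ => sq_nonneg _) (hs f)).trans (hle f)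
  -- The ranges are mutually orthogonal, so square-summability of the norms gives convergence of the
  -- vector series.
  have hfam : OrthogonalFamily ℂ (fun n => (LinearMap.range (P n : H →ₗ[ℂ] H)))
      (fun n => (LinearMap.range (P n : H →ₗ[ℂ] H)).subtypeₗᵢ) := by
    rintro a b hab ⟨_, f, rfl⟩ ⟨_, g, rfl⟩
    change ⟪P a f, P b g⟫_ℂ = 0
    rw [isStarProjection_inner_left (hP a), horth b a hab.symm, inner_zero_right]
  have hsum : ∀ f, Summable fun n => P n f := fun f =>
    (hfam.summable_iff_norm_sq_summable fun n => ⟨P n f, f, rfl⟩).2 (hs f).summable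
  have hPQ : ∀ m f, P m (∑' n, P n f) = P m f := fun m f => by
    rw [(P m).map_tsum (hsum f), tsum_eq_single m]
    · exact isStarProjection_apply_apply (hP m) f
    · exact fun b hb => horth b m hb f
  have hnorm : ∀ f, ‖∑' n, P n f‖ ^ 2 = s f := fun f => by
    have h1 : HasSum (fun n => ⟪∑' n, P n f, P n f⟫_ℂ) ⟪∑' n, P n f, ∑' n, P n f⟫_ℂ :=
      (hsum f).hasSum.mapL (innerSL ℂ (∑' n, P n f))
    have h2 : ∀ n, ⟪∑' n, P n f, P n f⟫_ℂ = ((‖P n f‖ ^ 2 : ℝ) : ℂ) := fun n => by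
      rw [← isStarProjection_inner_left (hP n), hPQ, isStarProjection_inner_self (hP n)]
    simp only [h2] at h1
    rw [inner_self_eq_norm_sq_to_K] at h1
    have h3 : HasSum (fun n => ((‖P n f‖ ^ 2 : ℝ) : ℂ)) ((‖∑' n, P n f‖ ^ 2 : ℝ) : ℂ) := by
      simpa using h1
    exact (Complex.hasSum_ofReal.1 h3).unique (hs f)
  let Q : H →L[ℂ] H := LinearMap.mkContinuous
    { toFun := fun f => ∑' n, P n f
      map_add' := fun f g => by simp only [map_add]; exact (hsum f).tsum_add (hsum g)
      map_smul' := fun c f => by simp only [map_smul]; exact (hsum f).tsum_const_smul c } 1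
    (fun f => by
      rw [one_mul]
      exact abs_le_of_sq_le_sq' ((hnorm f).trans_le (hle f)) (norm_nonneg _) |>.2)
  have hQ : ∀ f, Q f = ∑' n, P n f := fun f => rfl
  refine ⟨Q, isStarProjection_of_inner (fun f => ?_) (fun f g => ?_), fun f => (hsum f).hasSum,
    hnorm⟩
  · simp only [hQ, hPQ]
  · have h1 : HasSum (fun n => ⟪f, P n g⟫_ℂ) ⟪f, Q g⟫_ℂ := (hsum g).hasSum.mapL (innerSL ℂ f)
    have h2 : HasSum (fun n => ⟪g, P n f⟫_ℂ) ⟪g, Q f⟫_ℂ := (hsum f).hasSum.mapL (innerSL ℂ g)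
    have h3 := h2.map (starRingEnd ℂ) Complex.continuous_conj
    simp only [Function.comp_def, inner_conj_symm, isStarProjection_inner_left (hP _)] at h3
    exact h3.unique h1

/-- A projection-valued measure can be built from the scalar measures `‖E(B) f‖ ^ 2`, as soon as
these come from projections on a generating `π`-system. -/
theorem exists_isProjectionValuedMeasure {X : Type*} [mX : MeasurableSpace X] {C : Set (Set X)}
    (hgen : mX = MeasurableSpace.generateFrom C) (hpi : IsPiSystem C) (μ : H → Measure X)
    [∀ f, IsFiniteMeasure (μ f)] (huniv : ∀ f, (μ f).real univ = ‖f‖ ^ 2)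
    (hC : ∀ t ∈ C, ∃ P : H →L[ℂ] H, IsStarProjection P ∧ ∀ f, ‖P f‖ ^ 2 = (μ f).real t) :
    ∃ E : Set X → (H →L[ℂ] H), IsProjectionValuedMeasure E ∧
      ∀ B, MeasurableSet B → ∀ f, ‖E B f‖ ^ 2 = (μ f).real B := by
  have hle : ∀ f B, (μ f).real B ≤ ‖f‖ ^ 2 := fun f B =>
    (measureReal_mono (subset_univ B)).trans_eq (huniv f)
  have hsum : ∀ (f : H) (B : ℕ → Set X), (∀ n, MeasurableSet (B n)) →
      Pairwise (fun a b => Disjoint (B a) (B b)) →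
      HasSum (fun n => (μ f).real (B n)) ((μ f).real (⋃ n, B n)) := fun f B hB hd => by
    have h := measure_iUnion (μ := μ f) hd hB
    have h2 : ∑' n, (μ f) (B n) ≠ ∞ := h ▸ measure_ne_top _ _
    have h3 := ENNReal.hasSum_toReal h2
    rw [← ENNReal.tsum_toReal_eq (fun n => measure_ne_top _ _), ← h] at h3
    exact h3
  -- Induction from the π-system: complements are handled by `1 - P`, disjoint unions by the strong
  -- sum of the projections.
  have main : ∀ B, MeasurableSet B →
      ∃ P : H →L[ℂ] H, IsStarProjection P ∧ ∀ f, ‖P f‖ ^ 2 = (μ f).real B := by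
    refine MeasurableSpace.induction_on_inter hgen hpi ?_ hC ?_ ?_
    · exact ⟨0, IsStarProjection.zero _, fun f => by simp⟩
    · rintro t ht ⟨P, hP, h⟩
      refine ⟨1 - P, hP.one_sub, fun f => ?_⟩
      rw [norm_sq_one_sub_apply hP, h, measureReal_compl ht, huniv]
    · intro B hd hB h
      choose P hP hPn using h
      obtain ⟨Q, hQ, -, hQn⟩ := exists_isStarProjection_hasSum hP
        (s := fun f => (μ f).real (⋃ n, B n))
        (fun f => by simpa only [hPn] using hsum f B hB hd) (fun f => hle f _)
      exact ⟨Q, hQ, hQn⟩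
  classical
  choose! E hE hEn using main
  refine ⟨E, ⟨hE, ?_, ?_⟩, hEn⟩
  · refine isStarProjection_ext (hE _ .univ) (IsStarProjection.one _) fun f => ?_
    rw [hEn _ .univ, huniv]; rfl
  · intro B hB hd f
    obtain ⟨Q, hQ, hQs, hQn⟩ := exists_isStarProjection_hasSum (fun n => hE _ (hB n))
        (s := fun f => (μ f).real (⋃ n, B n))
        (fun f => by simpa only [hEn _ (hB _)] using hsum f B hB hd) (fun f => hle f _)
    have : E (⋃ n, B n) = Q := isStarProjection_ext (hE _ (.iUnion hB)) hQ fun f => by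
      rw [hEn _ (.iUnion hB), hQn]
    rw [this]
    exact hQs f

end Projections

/-! ### A finite measure from additive weights on the dyadic tree -/

section DyadicWeights

variable {c : ℕ → ℕ → ℝ}

theorem sum_dyadic_weights (hadd : ∀ p a, c p a = c (p + 1) (2 * a) + c (p + 1) (2 * a + 1))
    (q r k : ℕ) :
    ∑ a ∈ Finset.range (2 ^ r * k), c (q + r) a = ∑ a ∈ Finset.range k, c q a := by
  have step : ∀ q k, ∑ a ∈ Finset.range (2 * k), c (q + 1) a = ∑ a ∈ Finset.range k, c q a := by
    intro q k
    induction k with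
    | zero => simp
    | succ k ih =>
      rw [Finset.sum_range_succ, ← ih, hadd, mul_add, mul_one, Finset.sum_range_succ,
        Finset.sum_range_succ, add_assoc]
  induction r with
  | zero => simp
  | succ r ih => rw [← ih, ← step (q + r), pow_succ', mul_assoc, add_assoc]

/-- Weights on the dyadic tree, without mass escaping to the left endpoints from the left,
come from a finite measure on `ℝ`. -/
theorem exists_measure_of_dyadic_weights (h0 : ∀ p a, 0 ≤ c p a)
    (hadd : ∀ p a, c p a = c (p + 1) (2 * a) + c (p + 1) (2 * a + 1))
    (hzero : ∀ a, a ≠ 0 → c 0 a = 0)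
    (hlim : ∀ q k, Tendsto (fun r => c (q + r) (2 ^ r * (k + 1) - 1)) atTop (𝓝 0)) :
    ∃ μ : Measure ℝ, IsFiniteMeasure μ ∧
      ∀ p a : ℕ, μ (Ico ((a : ℝ) / 2 ^ p) (((a : ℝ) + 1) / 2 ^ p)) = ENNReal.ofReal (c p a) := by
  -- `G p k` is the mass intended for `[0, k/2^p)`; the distribution function `F` below is the
  -- supremum over `p` of its values at the dyadic floor of `x`.
  set G : ℕ → ℕ → ℝ := fun p k => ∑ a ∈ Finset.range k, c p a with hG
  have hGmono : ∀ p, Monotone (G p) := fun p a b hab =>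
    Finset.sum_le_sum_of_subset_of_nonneg (Finset.range_mono hab) fun _ _ _ => h0 _ _
  have hGnn : ∀ p k, 0 ≤ G p k := fun p k => Finset.sum_nonneg fun _ _ => h0 _ _
  have hGle : ∀ p k, G p k ≤ c 0 0 := fun p k => calc
    G p k ≤ G p (2 ^ p * k) := hGmono p (Nat.le_mul_of_pos_left k (by positivity))
    _ = G 0 k := by simpa using sum_dyadic_weights hadd 0 p k
    _ ≤ G 0 (k + 1) := hGmono 0 (Nat.le_succ k)
    _ = c 0 0 := by
      simp only [hG]
      rw [Finset.sum_eq_single 0 (fun b _ hb => hzero b hb) (by simp)]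
  set g : ℕ → ℝ → ℝ := fun p x => G p ⌊2 ^ p * x⌋₊ with hg
  have hgstep : ∀ x, Monotone fun p => g p x := fun x => monotone_nat_of_le_succ fun p => by
    simp only [hg]
    have h := sum_dyadic_weights hadd p 1 ⌊2 ^ p * x⌋₊
    rw [pow_one] at h
    change G (p + 1) _ = G p _ at h
    rw [← h]
    refine hGmono _ ?_
    rcases le_or_gt 0 x with hx | hx
    · refine Nat.le_floor ?_
      push_cast
      rw [pow_succ', mul_assoc]
      gcongr
      exact Nat.floor_le (by positivity)
    · rw [Nat.floor_of_nonpos (mul_nonpos_of_nonneg_of_nonpos (by positivity) hx.le)]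
      simp
  have hbdd : ∀ x, BddAbove (range fun p => g p x) := fun x =>
    ⟨c 0 0, by rintro _ ⟨p, rfl⟩; exact hGle _ _⟩
  set F : ℝ → ℝ := fun x => ⨆ p, g p x with hF
  have hFmono : Monotone F := fun x y hxy => ciSup_mono (hbdd y) fun p =>
    hGmono p (Nat.floor_mono (by gcongr))
  have hFd : ∀ q k : ℕ, F ((k : ℝ) / 2 ^ q) = G q k := by
    intro q k
    have key : ∀ p, g (q + p) ((k : ℝ) / 2 ^ q) = G q k := fun p => by
      have : (2 : ℝ) ^ (q + p) * (k / 2 ^ q) = ((2 ^ p * k : ℕ) : ℝ) := by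
        push_cast; rw [pow_add]; field_simp
      simp only [hg, this, Nat.floor_natCast]
      exact sum_dyadic_weights hadd q p k
    refine le_antisymm (ciSup_le fun p => ?_) ?_
    · exact (hgstep _ (Nat.le_add_left p q)).trans (key p).le
    · exact (key 0).ge.trans (le_ciSup (hbdd _) (q + 0))
  -- Left continuity of `F` at dyadic points. `F` at the preceding point of generation `q + r` falls
  -- short by exactly one weight, which tends to `0` by `hlim`.
  have hleft : ∀ q k : ℕ, Function.leftLim F ((k : ℝ) / 2 ^ q) = G q k := by
    intro q k
    refine le_antisymm ((hFmono.leftLim_le le_rfl).trans (hFd q k).le) ?_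
    rcases k with _ | k
    -- At the origin any negative point will do, as its natural-number floor is `0`.
    · have h1 : F (-1) ≤ Function.leftLim F (((0 : ℕ) : ℝ) / 2 ^ q) :=
        hFmono.le_leftLim (by simp)
      refine le_trans ?_ h1
      have : G q 0 = 0 := by simp [hG]
      rw [this]
      exact (hGnn _ _).trans (le_ciSup (hbdd (-1)) 0)
    · have h1 : ∀ r, G q (k + 1) - c (q + r) (2 ^ r * (k + 1) - 1) ≤
          Function.leftLim F (((k + 1 : ℕ) : ℝ) / 2 ^ q) := fun r => by
        have hpos : 1 ≤ 2 ^ r * (k + 1) := Nat.one_le_iff_ne_zero.2 (by positivity)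
        have h2 : G q (k + 1) - c (q + r) (2 ^ r * (k + 1) - 1) =
            F (((2 ^ r * (k + 1) - 1 : ℕ) : ℝ) / 2 ^ (q + r)) := by
          rw [hFd]
          have h3 : G (q + r) (2 ^ r * (k + 1)) = G q (k + 1) :=
            sum_dyadic_weights hadd q r (k + 1)
          obtain ⟨b, hb⟩ := Nat.exists_eq_add_of_le' hpos
          rw [← h3, hb]
          simp [hG, Finset.sum_range_succ]
        rw [h2]
        refine hFmono.le_leftLim ?_
        rw [div_lt_div_iff₀ (by positivity) (by positivity), pow_add]
        have h4 : ((2 ^ r * (k + 1) - 1 : ℕ) : ℝ) < 2 ^ r * ((k + 1 : ℕ) : ℝ) := by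
          rw [Nat.cast_sub hpos]; push_cast; linarith
        calc _ < 2 ^ r * ((k + 1 : ℕ) : ℝ) * 2 ^ q := by gcongr
          _ = _ := by ring
      have h5 : Tendsto (fun r => G q (k + 1) - c (q + r) (2 ^ r * (k + 1) - 1)) atTop
          (𝓝 (G q (k + 1) - 0)) := tendsto_const_nhds.sub (hlim q k)
      rw [sub_zero] at h5
      exact le_of_tendsto h5 (Eventually.of_forall h1)
  have hFnn : ∀ x, 0 ≤ F x := fun x => (hGnn _ _).trans (le_ciSup (hbdd x) 0)
  have hFle : ∀ x, F x ≤ c 0 0 := fun x => ciSup_le fun p => hGle _ _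
  refine ⟨hFmono.stieltjesFunction.measure,
    StieltjesFunction.isFiniteMeasure_of_forall_abs_le _ (C := c 0 0) fun x => ?_, fun p a => ?_⟩
  · rw [hFmono.stieltjesFunction_eq, abs_of_nonneg]
    · exact (hFmono.rightLim_le (lt_add_one x)).trans (hFle _)
    · exact (hFnn x).trans (hFmono.le_rightLim le_rfl)
  · rw [StieltjesFunction.measure_Ico]
    -- Passing to the right-continuous version of `F` does not change left limits, and these alone
    -- determine the measure of `Ico`.
    have hst : ∀ x, Function.leftLim hFmono.stieltjesFunction x = Function.leftLim F x := by
      intro x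
      refine le_antisymm ?_ ?_
      · refine le_of_tendsto (hFmono.stieltjesFunction.mono.tendsto_leftLim x) ?_
        filter_upwards [self_mem_nhdsWithin] with y hy
        rw [hFmono.stieltjesFunction_eq]
        exact hFmono.rightLim_le_leftLim hy
      · refine le_of_tendsto (hFmono.tendsto_leftLim x) ?_
        filter_upwards [self_mem_nhdsWithin] with y hy
        refine le_trans ?_ (hFmono.stieltjesFunction.mono.le_leftLim hy)
        rw [hFmono.stieltjesFunction_eq]
        exact hFmono.le_rightLim le_rfl
    have h1 := hleft p (a + 1)
    push_cast at h1
    rw [hst, hst, h1, hleft]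
    simp [hG, Finset.sum_range_succ]

end DyadicWeights

/-! ### Binary digits and dyadic intervals -/

section Branches

/-- The last digit is the least significant one, so halving the index removes the last letter of the
word. All inductions on `p` rest on this. -/
theorem frequencyIndex_succ (n : ℕ) {p : ℕ} (i : Fin (p + 1) → Fin 2) :
    frequencyIndex n i = 2 * frequencyIndex n (fun l : Fin p => i l.castSucc) + i (Fin.last p) := by
  simp only [frequencyIndex, Fin.sum_univ_castSucc, mul_add, Finset.mul_sum, Fin.val_castSucc,
    Fin.val_last, Nat.add_sub_cancel, Nat.sub_self, pow_zero, mul_one]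
  have : ∀ x : Fin p, 2 ^ (p - (x : ℕ)) = 2 * 2 ^ (p - 1 - (x : ℕ)) := fun x => by
    rw [← pow_succ']; congr 1; omega
  simp only [this]
  rw [← add_assoc]
  congr 1
  congr 1
  · ring
  · exact Finset.sum_congr rfl fun _ _ => by ring

theorem frequencyIndex_zero (n : ℕ) (i : Fin 0 → Fin 2) : frequencyIndex n i = n := by
  simp [frequencyIndex]

theorem frequencyIndex_div (n : ℕ) {p : ℕ} (i : Fin (p + 1) → Fin 2) :
    frequencyIndex n i / 2 = frequencyIndex n (fun l : Fin p => i l.castSucc) := by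
  rw [frequencyIndex_succ]; omega

theorem ofNat_frequencyIndex (n : ℕ) {p : ℕ} (i : Fin (p + 1) → Fin 2) :
    Fin.ofNat 2 (frequencyIndex n i) = i (Fin.last p) := by
  rw [frequencyIndex_succ]
  ext
  simp only [Fin.val_ofNat]
  omega

theorem dyadicPoint_eq {p : ℕ} (i : Fin p → Fin 2) :
    dyadicPoint i = (frequencyIndex 0 i : ℝ) / 2 ^ p := by
  simp only [dyadicPoint, frequencyIndex, mul_zero, zero_add, Nat.cast_sum, Finset.sum_div]
  refine Finset.sum_congr rfl fun l _ => ?_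
  have : (2 : ℝ) ^ p = 2 ^ (p - 1 - (l : ℕ)) * 2 ^ ((l : ℕ) + 1) := by
    rw [← pow_add]; congr 1; omega
  rw [this]
  push_cast
  field_simp

theorem dyadicInterval_eq {p : ℕ} (i : Fin p → Fin 2) :
    dyadicInterval i = Subtype.val ⁻¹'
      Ico ((frequencyIndex 0 i : ℝ) / 2 ^ p) ((frequencyIndex 0 i + 1 : ℝ) / 2 ^ p) := by
  ext x
  simp only [dyadicInterval, dyadicPoint_eq, Set.mem_ofPred_eq, mem_preimage, mem_Ico, add_div]

theorem mem_dyadicInterval {p : ℕ} (i : Fin p → Fin 2) (x : unitInterval) :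
    x ∈ dyadicInterval i ↔ ⌊2 ^ p * (x : ℝ)⌋₊ = frequencyIndex 0 i := by
  have h2 : (0 : ℝ) < 2 ^ p := by positivity
  rw [dyadicInterval_eq, mem_preimage, mem_Ico, div_le_iff₀ h2, lt_div_iff₀ h2,
    Nat.floor_eq_iff (mul_nonneg h2.le x.2.1), mul_comm]

theorem exists_frequencyIndex_of_lt {p a : ℕ} (ha : a < 2 ^ p) :
    ∃ i : Fin p → Fin 2, a = frequencyIndex 0 i := by
  induction p generalizing a with
  | zero => exact ⟨fun _ => 0, by rw [frequencyIndex_zero]; simpa using ha⟩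
  | succ p ih =>
    obtain ⟨i, hi⟩ := ih (a := a / 2) (by rw [pow_succ] at ha; omega)
    refine ⟨Fin.snoc i (Fin.ofNat 2 a), ?_⟩
    rw [frequencyIndex_succ]
    simp only [Fin.snoc_castSucc, Fin.snoc_last, ← hi, Fin.val_ofNat]
    omega

theorem frequencyIndex_lt {p : ℕ} (i : Fin p → Fin 2) : frequencyIndex 0 i < 2 ^ p := by
  induction p with
  | zero => simp [frequencyIndex_zero]
  | succ p ih =>
    rw [frequencyIndex_succ, pow_succ]
    have := ih (fun l => i l.castSucc)
    omega

/-- Dyadic intervals that meet are nested: the digits at generation `p` are the integer quotient by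
`2^r` of those at generation `p + r`. -/
theorem isPiSystem_dyadicInterval :
    IsPiSystem {t : Set unitInterval | ∃ (p : ℕ) (i : Fin p → Fin 2), t = dyadicInterval i} := by
  have key : ∀ p r (i : Fin p → Fin 2) (j : Fin (p + r) → Fin 2),
      (dyadicInterval i ∩ dyadicInterval j).Nonempty → dyadicInterval j ⊆ dyadicInterval i := by
    rintro p r i j ⟨x, hx, hx'⟩ y hy
    have h : ∀ z : unitInterval, ⌊2 ^ p * (z : ℝ)⌋₊ = ⌊2 ^ (p + r) * (z : ℝ)⌋₊ / 2 ^ r := by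
      intro z
      rw [← Nat.floor_div_natCast]
      congr 1
      push_cast
      rw [pow_add]; field_simp
    rw [mem_dyadicInterval] at *
    rw [h, hx', ← hy, ← h] at hx
    exact hx
  rintro _ ⟨p, i, rfl⟩ _ ⟨q, j, rfl⟩ hne
  rcases le_total p q with hpq | hpq
  · obtain ⟨r, rfl⟩ := Nat.exists_eq_add_of_le hpq
    exact ⟨_, j, inter_eq_right.2 (key p r i j hne)⟩
  · obtain ⟨r, rfl⟩ := Nat.exists_eq_add_of_le hpq
    exact ⟨_, i, inter_eq_left.2 (key q r j i (by rwa [inter_comm]))⟩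

theorem measurableSet_dyadicInterval {p : ℕ} (i : Fin p → Fin 2) :
    MeasurableSet (dyadicInterval i) := by
  rw [dyadicInterval_eq]
  exact measurable_subtype_coe measurableSet_Ico

theorem generateFrom_dyadicInterval : (inferInstance : MeasurableSpace unitInterval) =
    MeasurableSpace.generateFrom
      {t : Set unitInterval | ∃ (p : ℕ) (i : Fin p → Fin 2), t = dyadicInterval i} := by
  refine le_antisymm ?_ (MeasurableSpace.generateFrom_le ?_)
  · have h : (inferInstance : MeasurableSpace unitInterval) = borel unitInterval :=
      BorelSpace.measurable_eq
    rw [h, borel_eq_generateFrom_Iio]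
    refine MeasurableSpace.generateFrom_le ?_
    rintro _ ⟨c, rfl⟩
    have : Iio c = ⋃ (p : ℕ) (i : Fin p → Fin 2) (_ : dyadicInterval i ⊆ Iio c),
        dyadicInterval i := by
      refine Subset.antisymm (fun x hx => ?_) ?_
      · have hx' : (x : ℝ) < c := hx
        obtain ⟨p, hp⟩ := exists_pow_lt_of_lt_one (sub_pos.2 hx') (by norm_num : (1 / 2 : ℝ) < 1)
        have h2 : (0 : ℝ) < 2 ^ p := by positivity
        have hlt : ⌊2 ^ p * (x : ℝ)⌋₊ < 2 ^ p := by
          rw [Nat.floor_lt (mul_nonneg h2.le x.2.1)]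
          push_cast
          have := hx'.trans_le c.2.2
          nlinarith
        obtain ⟨i, hi⟩ := exists_frequencyIndex_of_lt hlt
        have hxi := (mem_dyadicInterval i x).2 hi
        refine mem_iUnion.2 ⟨p, mem_iUnion.2 ⟨i, mem_iUnion.2 ⟨fun y hy => ?_, hxi⟩⟩⟩
        change (y : ℝ) < c
        have h3 := hxi.1
        have h4 := hy.2
        rw [one_div_pow] at hp
        linarith
      · exact iUnion_subset fun p => iUnion_subset fun i => iUnion_subset fun h => h
    rw [this]
    exact .iUnion fun p => .iUnion fun i => .iUnion fun _ =>
      MeasurableSpace.measurableSet_generateFrom ⟨p, i, rfl⟩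
  · rintro _ ⟨p, i, rfl⟩
    exact measurableSet_dyadicInterval i

/-! ### Words in `S_0, S_1` and existence of the spectral measure -/

variable {H : Type*} [NormedAddCommGroup H] [InnerProductSpace ℂ H]

/-- The word `S_{i_1} ⋯ S_{i_p}` if `r = frequencyIndex n i`, and `0` if `r` is not of this form. -/
def branch (S : Fin 2 → (H →L[ℂ] H)) (n : ℕ) : ℕ → ℕ → (H →L[ℂ] H)
  | 0, r => if r = n then 1 else 0
  | p + 1, r => branch S n p (r / 2) * S (Fin.ofNat 2 r)

variable (S : Fin 2 → (H →L[ℂ] H))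

theorem word_succ {p : ℕ} (i : Fin (p + 1) → Fin 2) :
    word S i = word S (fun l : Fin p => i l.castSucc) * S (i (Fin.last p)) := by
  rw [word, List.ofFn_succ', List.concat_eq_append, List.prod_append, List.prod_singleton, word]

theorem branch_frequencyIndex (n : ℕ) {p : ℕ} (i : Fin p → Fin 2) :
    branch S n p (frequencyIndex n i) = word S i := by
  induction p with
  | zero => simp [branch, frequencyIndex_zero, word]
  | succ p ih => rw [branch, frequencyIndex_div, ofNat_frequencyIndex, ih, word_succ]

theorem branch_eq_zero {n p r : ℕ} (h : ∀ i : Fin p → Fin 2, r ≠ frequencyIndex n i) :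
    branch S n p r = 0 := by
  induction p generalizing r with
  | zero =>
    rw [branch, if_neg]
    simpa [frequencyIndex_zero] using h (fun _ => 0)
  | succ p ih =>
    rw [branch, ih, zero_mul]
    intro i hi
    refine h (Fin.snoc i (Fin.ofNat 2 r)) ?_
    rw [frequencyIndex_succ]
    simp only [Fin.snoc_castSucc, Fin.snoc_last, ← hi, Fin.val_ofNat]
    omega

/-- The index `2^r (k + 1) - 1` is `k` followed by `r` digits `1`: the last subinterval before the
right endpoint. The mass near that endpoint is thus governed by powers of `S_1`. -/
theorem branch_add_ones (n q k r : ℕ) :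
    branch S n (q + r) (2 ^ r * (k + 1) - 1) = branch S n q k * S 1 ^ r := by
  induction r with
  | zero => simp
  | succ r ih =>
    have hpos : 1 ≤ 2 ^ r * (k + 1) := Nat.one_le_iff_ne_zero.2 (by positivity)
    have h1 : 2 ^ (r + 1) * (k + 1) - 1 = 2 * (2 ^ r * (k + 1) - 1) + 1 := by
      rw [pow_succ', mul_assoc]; omega
    have h2 : (Fin.ofNat 2 (2 * (2 ^ r * (k + 1) - 1) + 1)) = 1 := by
      ext; simp only [Fin.val_ofNat, Fin.val_one]; omega
    rw [h1, ← add_assoc, branch, h2]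
    have h3 : (2 * (2 ^ r * (k + 1) - 1) + 1) / 2 = 2 ^ r * (k + 1) - 1 := by omega
    rw [h3, ih, pow_succ, mul_assoc]

theorem norm_word_apply (hiso : ∀ i f, ‖S i f‖ = ‖f‖) {p : ℕ} (i : Fin p → Fin 2) (f : H) :
    ‖word S i f‖ = ‖f‖ := by
  induction p generalizing f with
  | zero => simp [word]
  | succ p ih => rw [word_succ, mul_apply_eq_comp, ih, hiso]

variable [CompleteSpace H]

open ContinuousLinearMap in
theorem adjoint_mul_self_of_norm {A : H →L[ℂ] H} (hA : ∀ f, ‖A f‖ = ‖f‖) : adjoint A * A = 1 :=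
  (norm_map_iff_adjoint_comp_self A).1 hA

open ContinuousLinearMap in
theorem isStarProjection_mul_adjoint {A : H →L[ℂ] H} (hA : ∀ f, ‖A f‖ = ‖f‖) :
    IsStarProjection (A * adjoint A) := by
  refine ⟨?_, ?_⟩
  · change A * adjoint A * (A * adjoint A) = A * adjoint A
    rw [mul_assoc, ← mul_assoc (adjoint A), adjoint_mul_self_of_norm hA, one_mul]
  · exact IsSelfAdjoint.mul_star_self A

open ContinuousLinearMap in
/-- Two isometries with complementary ranges, the second one being a pure isometry, have a
projection-valued measure on `[0, 1]`. -/
theorem exists_isDyadicSpectralMeasure (hiso : ∀ i f, ‖S i f‖ = ‖f‖)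
    (hsum : ∀ f, ‖adjoint (S 0) f‖ ^ 2 + ‖adjoint (S 1) f‖ ^ 2 = ‖f‖ ^ 2)
    (hlim : ∀ f, Tendsto (fun r : ℕ => (adjoint (S 1) ^ r) f) atTop (𝓝 0)) :
    ∃ E, IsDyadicSpectralMeasure S E := by
  have hmul : ∀ A B : H →L[ℂ] H, ∀ f, adjoint (A * B) f = adjoint B (adjoint A f) := fun A B f => by
    change adjoint (A ∘L B) f = _
    rw [adjoint_comp]; rfl
  have hexists : ∀ f : H, ∃ μ : Measure ℝ, IsFiniteMeasure μ ∧
      ∀ p a : ℕ, μ (Ico ((a : ℝ) / 2 ^ p) (((a : ℝ) + 1) / 2 ^ p)) =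
        ENNReal.ofReal (‖adjoint (branch S 0 p a) f‖ ^ 2) := fun f => by
    refine exists_measure_of_dyadic_weights (fun _ _ => sq_nonneg _) (fun p a => ?_)
      (fun a ha => ?_) (fun q k => ?_)
    · have h1 : (2 * a) / 2 = a := by omega
      have h2 : (2 * a + 1) / 2 = a := by omega
      have h3 : Fin.ofNat 2 (2 * a) = 0 := by ext; simp
      have h4 : Fin.ofNat 2 (2 * a + 1) = 1 := by ext; simp
      simp only [branch, h1, h2, h3, h4, hmul, hsum]
    · simp [branch, ha]
    -- The weight next to the right endpoint is the squared norm of `S_1^{*r}` applied to a fixed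
    -- vector; purity of `S_1` enters here.
    · simp only [branch_add_ones, hmul]
      have h1 : ∀ r : ℕ, adjoint (S 1 ^ r) = adjoint (S 1) ^ r := fun r => star_pow (S 1) r
      simp only [h1]
      simpa using ((hlim (adjoint (branch S 0 q k) f)).norm.pow 2)
  choose ν hν hνI using hexists
  let μ : H → Measure unitInterval := fun f => (ν f).comap Subtype.val
  have hμ : ∀ f B, MeasurableSet B → μ f B = ν f (Subtype.val '' B) := fun f B hB =>
    (MeasurableEmbedding.subtype_coe measurableSet_Icc).comap_apply _ _
  have hfin : ∀ f, IsFiniteMeasure (μ f) := fun f =>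
    ⟨by rw [hμ f _ .univ]; exact measure_lt_top _ _⟩
  have hdy : ∀ f (p : ℕ) (i : Fin p → Fin 2),
      (μ f).real (dyadicInterval i) = ‖adjoint (word S i) f‖ ^ 2 := by
    intro f p i
    have hsub : Ico ((frequencyIndex 0 i : ℝ) / 2 ^ p) ((frequencyIndex 0 i + 1 : ℝ) / 2 ^ p) ⊆
        Set.Icc (0 : ℝ) 1 := by
      intro x hx
      have h2 : (0 : ℝ) < 2 ^ p := by positivity
      refine ⟨le_trans (by positivity) hx.1, hx.2.le.trans ?_⟩
      rw [div_le_one h2]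
      exact_mod_cast frequencyIndex_lt i
    rw [Measure.real, hμ f _ (measurableSet_dyadicInterval i), dyadicInterval_eq,
      Subtype.image_preimage_coe, inter_eq_right.2 hsub, hνI, branch_frequencyIndex,
      ENNReal.toReal_ofReal (sq_nonneg _)]
  have huniv : ∀ f, (μ f).real univ = ‖f‖ ^ 2 := by
    intro f
    have h0 := hνI f 0 0
    have h1 := hνI f 0 1
    have h10 : adjoint (1 : H →L[ℂ] H) = 1 := star_one _
    simp [branch, h10] at h0 h1
    -- The point `1` carries no mass: it lies in `[1, 2)`, whose weight is `0` because `branch S 0 0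
    -- 1 = 0`.
    have h2 : ν f (Set.Icc 0 1) = ENNReal.ofReal (‖f‖ ^ 2) := by
      refine le_antisymm ?_ ?_
      · calc ν f (Set.Icc 0 1) ≤ ν f (Ico 0 1 ∪ Ico 1 (1 + 1)) := by
              refine measure_mono fun x hx => ?_
              rcases hx.2.lt_or_eq with h | h
              · exact Or.inl ⟨hx.1, h⟩
              · exact Or.inr ⟨h.ge, by linarith⟩
          _ ≤ ν f (Ico 0 1) + ν f (Ico 1 (1 + 1)) := measure_union_le _ _
          _ = _ := by rw [h0, h1]; simp
      · have : ν f (Ico 0 1) ≤ ν f (Set.Icc 0 1) := measure_mono Ico_subset_Icc_self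
        rw [h0] at this
        simpa using this
    rw [Measure.real, hμ f _ .univ, image_univ, Subtype.range_coe]
    change (ν f (Set.Icc 0 1)).toReal = _
    rw [h2, ENNReal.toReal_ofReal (sq_nonneg _)]
  have hproj : ∀ (p : ℕ) (i : Fin p → Fin 2), IsStarProjection (word S i * adjoint (word S i)) :=
    fun p i => isStarProjection_mul_adjoint (norm_word_apply S hiso i)
  have hnorm : ∀ f (p : ℕ) (i : Fin p → Fin 2),
      ‖(word S i * adjoint (word S i)) f‖ ^ 2 = (μ f).real (dyadicInterval i) := fun f p i => by
    rw [mul_apply_eq_comp, norm_word_apply S hiso, hdy]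
  obtain ⟨E, hE, hEn⟩ := exists_isProjectionValuedMeasure generateFrom_dyadicInterval
    isPiSystem_dyadicInterval μ huniv (by
      rintro _ ⟨p, i, rfl⟩
      exact ⟨_, hproj p i, fun f => hnorm f p i⟩)
  refine ⟨E, hE, fun p i => isStarProjection_ext
    (hE.isStarProjection _ (measurableSet_dyadicInterval i)) (hproj p i) fun f => ?_⟩
  rw [hEn _ (measurableSet_dyadicInterval i), hnorm]

theorem isDyadicSpectralMeasure_spectralMeasure (h : ∃ E, IsDyadicSpectralMeasure S E) :
    IsDyadicSpectralMeasure S (spectralMeasure S) := by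
  rw [spectralMeasure, dif_pos h]
  exact h.choose_spec

end Branches

/-! ### Dilation and translation under the Fourier transform -/

section FourierSide

theorem exists_subseq_tendsto_ae {X : Type*} [MeasurableSpace X] {μ : Measure X}
    {f : ℕ → Lp ℂ 2 μ} {g : Lp ℂ 2 μ} (h : Tendsto f atTop (𝓝 g)) :
    ∃ ns : ℕ → ℕ, StrictMono ns ∧
      ∀ᵐ x ∂μ, Tendsto (fun i => f (ns i) x) atTop (𝓝 (g x)) :=
  (tendstoInMeasure_of_tendsto_Lp h).exists_seq_tendsto_ae

/-- `L²` convergence gives a.e. convergence along a subsequence, and quasi-preservation carries this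
through `τ`. Multiplier identities can therefore be checked on a dense set, with no bound on `w`. -/
theorem isClosed_setOf_ae_eq_mul {Y X : Type*} [PseudoMetricSpace Y] [MeasurableSpace X]
    {μ : Measure X} {A : Y → L2R} (hA : Continuous A) {B : Y → Lp ℂ 2 μ} (hB : Continuous B)
    {τ : ℝ → X} (hτ : Measure.QuasiMeasurePreserving τ volume μ) (w : ℝ → ℂ) :
    IsClosed {y | A y =ᵐ[volume] fun x => w x * B y (τ x)} := by
  refine IsSeqClosed.isClosed fun y z hy hz => ?_
  obtain ⟨ns, hns, h1⟩ := exists_subseq_tendsto_ae ((hA.tendsto z).comp hz)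
  obtain ⟨ms, hms, h2⟩ :=
    exists_subseq_tendsto_ae (((hB.tendsto z).comp hz).comp hns.tendsto_atTop)
  have h3 : ∀ᵐ x, ∀ i, A (y i) x = w x * B (y i) (τ x) := ae_all_iff.2 hy
  filter_upwards [h1, hτ.ae h2, h3] with x h1 h2 h3
  refine tendsto_nhds_unique (h1.comp hms.tendsto_atTop) ?_
  simp only [Function.comp_def, h3] at h2 ⊢
  exact h2.const_mul _

/-- Only null sets need to be controlled: the line is a countable union of periods, each mapped to
the circle preserving measure. -/
theorem quasiMeasurePreserving_coe :
    Measure.QuasiMeasurePreserving (fun x : ℝ => (x : UnitAddCircle)) volume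
      AddCircle.haarAddCircle := by
  refine ⟨AddCircle.measurable_mk', Measure.AbsolutelyContinuous.mk fun s hs h0 => ?_⟩
  rw [Measure.map_apply AddCircle.measurable_mk' hs]
  have hv : (volume : Measure UnitAddCircle) s = 0 := by
    rw [AddCircle.volume_eq_smul_haarAddCircle]; simp [h0]
  have hcov : (fun x : ℝ => (x : UnitAddCircle)) ⁻¹' s ⊆
      ⋃ n : ℤ, (fun x : ℝ => (x : UnitAddCircle)) ⁻¹' s ∩ Ioc (n : ℝ) (n + 1) := fun x hx => by
    have := iUnion_Ioc_intCast ℝ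
    obtain ⟨n, hn⟩ := mem_iUnion.1 (this.ge (mem_univ x))
    exact mem_iUnion.2 ⟨n, hx, hn⟩
  refine measure_mono_null hcov (measure_iUnion_null fun n => ?_)
  have h := (UnitAddCircle.measurePreserving_mk (n : ℝ)).measure_preimage hs.nullMeasurableSet
  rw [Measure.restrict_apply (AddCircle.measurable_mk' hs)] at h
  exact h.trans hv

theorem quasiMeasurePreserving_coe_neg :
    Measure.QuasiMeasurePreserving (fun x : ℝ => ((-x : ℝ) : UnitAddCircle)) volume
      AddCircle.haarAddCircle :=
  quasiMeasurePreserving_coe.comp (Measure.measurePreserving_neg volume).quasiMeasurePreserving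

theorem quasiMeasurePreserving_mul_left {a : ℝ} (ha : a ≠ 0) :
    Measure.QuasiMeasurePreserving (fun x : ℝ => a * x) volume volume := by
  refine ⟨measurable_const_mul a, ?_⟩
  rw [Real.map_volume_mul_left ha]
  exact Measure.smul_absolutelyContinuous

theorem quasiMeasurePreserving_half :
    Measure.QuasiMeasurePreserving (fun x : ℝ => x / 2) volume volume := by
  simpa only [div_eq_inv_mul] using quasiMeasurePreserving_mul_left (a := (2 : ℝ)⁻¹) (by norm_num)

theorem norm_sq_eq_integral {X : Type*} [MeasurableSpace X] {μ : Measure X} (f : Lp ℂ 2 μ) :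
    ‖f‖ ^ 2 = ∫ x, ‖f x‖ ^ 2 ∂μ := by
  have h := congrArg RCLike.re (L2.inner_def (𝕜 := ℂ) f f)
  rw [← integral_re] at h
  · simpa [← norm_sq_eq_re_inner, ← Complex.ofReal_pow] using h
  · exact L2.integrable_inner f f

theorem packet_coeFn (p : ℕ) (k : ℤ) (f : L2R) :
    packet p k f =ᵐ[volume]
      fun t : ℝ => (((2 : ℝ) ^ ((p : ℝ) / 2) : ℝ) : ℂ) * f (2 ^ p * t - k) :=
  MemLp.coeFn_toLp _

theorem packet_one_coeFn (f : L2R) :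
    packet 1 0 f =ᵐ[volume] fun t : ℝ => ((√2 : ℝ) : ℂ) * f (2 * t) := by
  filter_upwards [packet_coeFn 1 0 f] with t ht
  rw [ht, Real.sqrt_eq_rpow]
  simp

theorem norm_packet_one (f : L2R) : ‖packet 1 0 f‖ = ‖f‖ := by
  rw [← sq_eq_sq₀ (norm_nonneg _) (norm_nonneg _), norm_sq_eq_integral, norm_sq_eq_integral]
  have : ∫ t, ‖packet 1 0 f t‖ ^ 2 = ∫ t, 2 * ‖f (2 * t)‖ ^ 2 := by
    refine integral_congr_ae ?_
    filter_upwards [packet_one_coeFn f] with t ht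
    rw [ht, norm_mul, mul_pow, Complex.norm_real, Real.norm_eq_abs, sq_abs,
      Real.sq_sqrt (by norm_num)]
  rw [this, integral_const_mul, Measure.integral_comp_mul_left (fun t => ‖f t‖ ^ 2) 2]
  simp

/-- The dilation `(U f)(t) = √2 f(2t)`. -/
noncomputable def dilation : L2R →ₗᵢ[ℂ] L2R where
  toFun := packet 1 0
  map_add' f g := by
    refine Lp.ext ?_
    filter_upwards [packet_one_coeFn (f + g), packet_one_coeFn f, packet_one_coeFn g,
      Lp.coeFn_add (packet 1 0 f) (packet 1 0 g),
      (quasiMeasurePreserving_mul_left two_ne_zero).ae (Lp.coeFn_add f g)] with t h1 h2 h3 h4 h5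
    rw [h1, h4, Pi.add_apply, h2, h3, h5, Pi.add_apply, mul_add]
  map_smul' c f := by
    refine Lp.ext ?_
    filter_upwards [packet_one_coeFn (c • f), packet_one_coeFn f,
      Lp.coeFn_smul c (packet 1 0 f),
      (quasiMeasurePreserving_mul_left two_ne_zero).ae (Lp.coeFn_smul c f)] with t h1 h2 h3 h4
    rw [RingHom.id_apply, h1, h3, Pi.smul_apply, h2, h4, Pi.smul_apply, smul_eq_mul, smul_eq_mul]
    ring
  norm_map' := norm_packet_one

theorem dilation_coeFn (f : L2R) :
    dilation f =ᵐ[volume] fun t : ℝ => ((√2 : ℝ) : ℂ) * f (2 * t) :=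
  packet_one_coeFn f

theorem translate_coeFn (j : ℤ) (f : L2R) :
    translate j f =ᵐ[volume] fun t : ℝ => f (t - j) :=
  Lp.coeFn_compMeasurePreserving f (measurePreserving_sub_right volume (j : ℝ))

theorem packet_succ (p : ℕ) (k : ℤ) (f : L2R) :
    packet (p + 1) k f = dilation (packet p k f) := by
  refine Lp.ext ?_
  filter_upwards [packet_coeFn (p + 1) k f, dilation_coeFn (packet p k f),
    (quasiMeasurePreserving_mul_left two_ne_zero).ae (packet_coeFn p k f)] with t h1 h2 h3
  rw [h1, h2, h3, ← mul_assoc, ← mul_assoc, ← Complex.ofReal_mul, ← pow_succ]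
  congr 2
  rw [Real.sqrt_eq_rpow, ← Real.rpow_add (by norm_num)]
  congr 1
  push_cast
  ring

theorem packet_zero (k : ℤ) (f : L2R) : packet 0 k f = translate k f := by
  refine Lp.ext ?_
  filter_upwards [packet_coeFn 0 k f, translate_coeFn k f] with t h1 h2
  rw [h1, h2]
  simp

/-- The translation by `j` as a linear isometry. -/
noncomputable def translateₗᵢ (j : ℤ) : L2R →ₗᵢ[ℂ] L2R :=
  Lp.compMeasurePreservingₗᵢ ℂ _ (measurePreserving_sub_right volume (j : ℝ))

theorem continuous_translate (j : ℤ) : Continuous (translate j) := (translateₗᵢ j).continuous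

theorem continuous_fourier_L2R : Continuous (fun f : L2R => (𝓕 f : L2R)) :=
  (Lp.fourierTransformₗᵢ ℝ ℂ).continuous

theorem denseRange_schwartz : DenseRange (fun s : SchwartzMap ℝ ℂ => s.toLp 2 volume) :=
  SchwartzMap.denseRange_toLpCLM (F := ℂ) (p := 2) ENNReal.ofNat_ne_top

theorem fourier_toLp_coeFn (s : SchwartzMap ℝ ℂ) :
    (𝓕 (s.toLp 2 volume) : L2R) =ᵐ[volume]
      fun x => ∫ t : ℝ, Complex.exp (↑(-2 * Real.pi * t * x) * Complex.I) * s t := by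
  rw [SchwartzMap.toLp_fourier_eq]
  filter_upwards [(𝓕 s).coeFn_toLp 2 volume] with x hx
  rw [hx, SchwartzMap.fourier_coe, Real.fourier_real_eq_integral_exp_smul]
  simp only [smul_eq_mul]

/-- A change of variable in the Fourier integral of a Schwartz function, extended by density. -/
theorem fourier_dilation (f : L2R) :
    (𝓕 (dilation f) : L2R) =ᵐ[volume]
      fun x : ℝ => (((√2)⁻¹ : ℝ) : ℂ) * (𝓕 f : L2R) (x / 2) := by
  refine denseRange_schwartz.induction_on (p := fun f : L2R => (𝓕 (dilation f) : L2R) =ᵐ[volume]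
      fun x : ℝ => (((√2)⁻¹ : ℝ) : ℂ) * (𝓕 f : L2R) (x / 2)) f
    (isClosed_setOf_ae_eq_mul (continuous_fourier_L2R.comp dilation.continuous)
      continuous_fourier_L2R quasiMeasurePreserving_half _) fun s => ?_
  let L : ℝ ≃L[ℝ] ℝ := ContinuousLinearEquiv.unitsEquivAut ℝ (Units.mk0 2 two_ne_zero)
  have hL : ∀ t, L t = 2 * t := fun t => by simp [L, mul_comm]
  let s' : SchwartzMap ℝ ℂ :=
    ((√2 : ℝ) : ℂ) • SchwartzMap.compCLMOfContinuousLinearEquiv ℂ L s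
  have hs' : ∀ t, s' t = ((√2 : ℝ) : ℂ) * s (2 * t) := fun t => by
    simp [s', hL]
  have h1 : dilation (s.toLp 2 volume) = s'.toLp 2 volume := by
    refine Lp.ext ?_
    filter_upwards [dilation_coeFn (s.toLp 2 volume), s'.coeFn_toLp 2 volume,
      (quasiMeasurePreserving_mul_left two_ne_zero).ae (s.coeFn_toLp 2 volume)] with t h1 h2 h3
    rw [h1, h2, h3, hs']
  change (𝓕 (dilation (s.toLp 2 volume)) : L2R) =ᵐ[volume] _
  rw [h1]
  filter_upwards [fourier_toLp_coeFn s',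
    quasiMeasurePreserving_half.ae (fourier_toLp_coeFn s)] with x h2 h3
  rw [h2, h3]
  have h4 : ∀ t : ℝ, Complex.exp (↑(-2 * Real.pi * t * x) * Complex.I) * s' t =
      ((√2 : ℝ) : ℂ) *
        (fun u : ℝ => Complex.exp (↑(-2 * Real.pi * u * (x / 2)) * Complex.I) * s u) (2 * t) := by
    intro t
    simp only [hs']
    have : -2 * Real.pi * (2 * t) * (x / 2) = -2 * Real.pi * t * x := by ring
    rw [this]; ring
  simp only [h4]
  rw [integral_const_mul, Measure.integral_comp_mul_left (fun u : ℝ =>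
    Complex.exp (↑(-2 * Real.pi * u * (x / 2)) * Complex.I) * s u) 2]
  rw [← Complex.coe_smul, smul_eq_mul, ← mul_assoc, ← Complex.ofReal_mul]
  congr 2
  have h5 : √2 * √2 = (2 : ℝ) := Real.mul_self_sqrt (by norm_num)
  rw [abs_of_pos (by norm_num)]
  field_simp
  linarith

theorem fourier_translate (j : ℤ) (f : L2R) :
    (𝓕 (translate j f) : L2R) =ᵐ[volume]
      fun x : ℝ => Complex.exp (↑(-2 * Real.pi * j * x) * Complex.I) * (𝓕 f : L2R) x := by
  refine denseRange_schwartz.induction_on (p := fun f : L2R => (𝓕 (translate j f) : L2R) =ᵐ[volume]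
      fun x : ℝ => Complex.exp (↑(-2 * Real.pi * j * x) * Complex.I) * (𝓕 f : L2R) (id x)) f
    (isClosed_setOf_ae_eq_mul (continuous_fourier_L2R.comp (continuous_translate j))
      continuous_fourier_L2R (.id _) _) fun s => ?_
  let s' : SchwartzMap ℝ ℂ := SchwartzMap.compSubConstCLM ℂ (j : ℝ) s
  have hs' : ∀ t, s' t = s (t - j) := fun t => rfl
  have h1 : translate j (s.toLp 2 volume) = s'.toLp 2 volume := by
    refine Lp.ext ?_
    filter_upwards [translate_coeFn j (s.toLp 2 volume), s'.coeFn_toLp 2 volume,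
      (measurePreserving_sub_right volume (j : ℝ)).quasiMeasurePreserving.ae
        (s.coeFn_toLp 2 volume)] with t h1 h2 h3
    rw [h1, h2, h3, hs']
  change (𝓕 (translate j (s.toLp 2 volume)) : L2R) =ᵐ[volume] _
  rw [h1]
  filter_upwards [fourier_toLp_coeFn s', fourier_toLp_coeFn s] with x h2 h3
  rw [h2, id, h3, ← integral_const_mul]
  refine Eq.trans ?_ (integral_sub_right_eq_self _ (j : ℝ))
  refine integral_congr_ae (Eventually.of_forall fun t => ?_)
  simp only [hs']
  rw [← mul_assoc, ← Complex.exp_add]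
  congr 2
  push_cast
  ring

end FourierSide

/-! ### Synthesis operators and the refinement equation -/

section Synthesis

/-- The isometry `L²(𝕋) → L²(ℝ)` which sends `e_j` to the `j`-th vector of an orthonormal family. -/
noncomputable def synthesis {v : ℤ → L2R} (hv : Orthonormal ℂ v) : L2T →ₗᵢ[ℂ] L2R :=
  hv.orthogonalFamily.linearIsometry.comp
    (fourierBasis (T := 1)).repr.toLinearIsometry

theorem synthesis_e {v : ℤ → L2R} (hv : Orthonormal ℂ v) (j : ℤ) : synthesis hv (e j) = v j := by
  have h1 : e j = (fourierBasis (T := 1)) j := by rw [coe_fourierBasis]; rfl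
  simp only [synthesis, LinearIsometry.coe_comp, Function.comp_apply,
    LinearIsometryEquiv.coe_toLinearIsometry, h1, HilbertBasis.repr_self]
  rw [OrthogonalFamily.linearIsometry_apply_single]
  simp

theorem e_coeFn (j : ℤ) : e j =ᵐ[AddCircle.haarAddCircle] fourier (T := 1) j :=
  coeFn_fourierLp 2 j

/-- Translation by `j` becomes multiplication by `exp(-2πijx) = e_j(-x)`, whence the sign in
`g(-x)`. Both sides are linear in `g` and the identity is closed, so the characters suffice. -/
theorem fourier_synthesis {ψ : L2R} (hψ : Orthonormal ℂ fun j : ℤ => translate j ψ) (g : L2T) :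
    (𝓕 (synthesis hψ g) : L2R) =ᵐ[volume]
      fun x : ℝ => (𝓕 ψ : L2R) x * g ((-x : ℝ) : UnitAddCircle) := by
  have hcl := isClosed_setOf_ae_eq_mul (Y := L2T) (A := fun g => (𝓕 (synthesis hψ g) : L2R))
    (continuous_fourier_L2R.comp (synthesis hψ).continuous) (B := id) continuous_id
    quasiMeasurePreserving_coe_neg (fun x => (𝓕 ψ : L2R) x)
  let F : L2T →ₗᵢ[ℂ] L2R := (Lp.fourierTransformₗᵢ ℝ ℂ).toLinearIsometry.comp (synthesis hψ)
  have hF : ∀ g, (𝓕 (synthesis hψ g) : L2R) = F g := fun _ => rfl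
  simp only [hF] at hcl ⊢
  let K : Submodule ℂ L2T :=
    { carrier := {y | F y =ᵐ[volume]
        fun x : ℝ => (𝓕 ψ : L2R) x * id y ((-x : ℝ) : UnitAddCircle)}
      zero_mem' := by
        simp only [Set.mem_ofPred_eq, map_zero, id]
        filter_upwards [Lp.coeFn_zero ℂ 2 (volume : Measure ℝ),
          quasiMeasurePreserving_coe_neg.ae (Lp.coeFn_zero ℂ 2 AddCircle.haarAddCircle)]
          with x h1 h2
        rw [h1, h2]; simp
      add_mem' := fun {a b} ha hb => by
        simp only [Set.mem_ofPred_eq, map_add, id] at *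
        filter_upwards [ha, hb, Lp.coeFn_add (F a) (F b),
          quasiMeasurePreserving_coe_neg.ae (Lp.coeFn_add a b)] with x h1 h2 h3 h4
        rw [h3, h4, Pi.add_apply, Pi.add_apply, h1, h2, mul_add]
      smul_mem' := fun c a ha => by
        simp only [Set.mem_ofPred_eq, map_smul, id] at *
        filter_upwards [ha, Lp.coeFn_smul c (F a),
          quasiMeasurePreserving_coe_neg.ae (Lp.coeFn_smul c a)] with x h1 h2 h3
        rw [h2, h3, Pi.smul_apply, Pi.smul_apply, h1, smul_eq_mul, smul_eq_mul]
        ring }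
  have hle : (Submodule.span ℂ (range (fourierLp (T := 1) 2))).topologicalClosure ≤ K := by
    refine Submodule.topologicalClosure_minimal _ (Submodule.span_le.2 ?_) hcl
    rintro _ ⟨j, rfl⟩
    change F (e j) =ᵐ[volume] fun x : ℝ => (𝓕 ψ : L2R) x * e j ((-x : ℝ) : UnitAddCircle)
    rw [← hF, synthesis_e]
    filter_upwards [fourier_translate j ψ, quasiMeasurePreserving_coe_neg.ae (e_coeFn j)]
      with x h1 h2
    rw [h1, h2, fourier_coe_apply, mul_comm]
    congr 2
    push_cast
    ring
  rw [span_fourierLp_closure_eq_top (by simp)] at hle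
  exact hle (Submodule.mem_top : g ∈ ⊤)

theorem fourier_injective_L2R {f g : L2R} (h : (𝓕 f : L2R) = 𝓕 g) : f = g :=
  (Lp.fourierTransformₗᵢ ℝ ℂ).injective h

/-- The refinement equation on the level of synthesis operators. -/
theorem synthesis_eq_dilation {ψ φ : L2R} (hψ : Orthonormal ℂ fun j : ℤ => translate j ψ)
    (hφ : Orthonormal ℂ fun j : ℤ => translate j φ)
    (u : Circle → ℂ) (hu : Measurable u) (C : ℝ) (hC : ∀ z, ‖u z‖ ≤ C)
    (h : (𝓕 ψ : L2R) =ᵐ[volume] fun x : ℝ =>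
      (((√2)⁻¹ : ℝ) : ℂ) * u (Circle.exp (-(2 * Real.pi * (x / 2)))) * (𝓕 φ : L2R) (x / 2))
    (g : L2T) :
    synthesis hψ g = dilation (synthesis hφ (filterOp u hu C hC g)) := by
  refine fourier_injective_L2R (Lp.ext ?_)
  filter_upwards [h, fourier_synthesis hψ g, fourier_dilation (synthesis hφ (filterOp u hu C hC g)),
    quasiMeasurePreserving_half.ae (fourier_synthesis hφ (filterOp u hu C hC g)),
    quasiMeasurePreserving_half.ae
      (quasiMeasurePreserving_coe_neg.ae (filterOp_apply u hu C hC g))] with x h1 h2 h3 h4 h5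
  rw [h3, h4, h5, h2, h1, AddCircle.toCircle_apply_mk]
  have h6 : 2 * Real.pi / 1 * -(x / 2) = -(2 * Real.pi * (x / 2)) := by ring
  have h7 : (2 : ℕ) • ((-(x / 2) : ℝ) : UnitAddCircle) = ((-x : ℝ) : UnitAddCircle) := by
    rw [← AddCircle.coe_nsmul]; congr 1; simp; ring
  rw [h6, h7]
  ring

end Synthesis

section Packets

variable {m : QMF} {φ : ℕ → L2R}

theorem IsTranslateBasis.orthonormal_translate (hb : IsTranslateBasis φ) (r : ℕ) :
    Orthonormal ℂ fun j : ℤ => translate j (φ r) :=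
  hb.orthonormal.comp (fun j : ℤ => (r, j)) fun _ _ h => (Prod.ext_iff.1 h).2

/-- `W_r : L²(𝕋) → L²(ℝ)`, `e_j ↦ φ_r(· - j)`. -/
noncomputable def IsTranslateBasis.packetSynthesis (hb : IsTranslateBasis φ) (r : ℕ) :
    L2T →ₗᵢ[ℂ] L2R :=
  synthesis (hb.orthonormal_translate r)

theorem IsTranslateBasis.packetSynthesis_e (hb : IsTranslateBasis φ) (r : ℕ) (j : ℤ) :
    hb.packetSynthesis r (e j) = translate j (φ r) :=
  synthesis_e _ j

end Packets

/-! ### Cuntz relations and the marginals of the packet distribution -/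

section PacketOperators

open ContinuousLinearMap

variable {m : QMF} {φ : ℕ → L2R}

theorem dense_span_e : Dense (Submodule.span ℂ (range e) : Set L2T) :=
  Submodule.dense_iff_topologicalClosure_eq_top.2 (span_fourierLp_closure_eq_top (by simp))

theorem hasSum_norm_inner_sq {ι H : Type*} [NormedAddCommGroup H] [InnerProductSpace ℂ H]
    (b : HilbertBasis ι ℂ H) (x : H) : HasSum (fun i => ‖⟪b i, x⟫_ℂ‖ ^ 2) (‖x‖ ^ 2) := by
  have h := b.hasSum_inner_mul_inner x x
  have h1 : ∀ i, ⟪x, b i⟫_ℂ * ⟪b i, x⟫_ℂ = ((‖⟪b i, x⟫_ℂ‖ ^ 2 : ℝ) : ℂ) := fun i => by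
    rw [← inner_conj_symm, ← Complex.normSq_eq_conj_mul_self, Complex.normSq_eq_norm_sq]
  simp only [h1, inner_self_eq_norm_sq_to_K] at h
  have h2 : HasSum (fun i => ((‖⟪b i, x⟫_ℂ‖ ^ 2 : ℝ) : ℂ)) ((‖x‖ ^ 2 : ℝ) : ℂ) := by
    simpa using h
  exact Complex.hasSum_ofReal.1 h2

theorem hasSum_norm_inner_e_sq (x : L2T) :
    HasSum (fun j => ‖⟪e j, x⟫_ℂ‖ ^ 2) (‖x‖ ^ 2) := by
  have h := hasSum_norm_inner_sq (fourierBasis (T := 1)) x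
  rwa [coe_fourierBasis] at h

namespace IsTranslateBasis

theorem inner_packetSynthesis_eq_zero (hb : IsTranslateBasis φ) {r : ℕ} {y : L2R}
    (h : ∀ j, ⟪y, translate j (φ r)⟫_ℂ = 0) (g : L2T) : ⟪y, hb.packetSynthesis r g⟫_ℂ = 0 := by
  have : (innerSL ℂ y).comp (hb.packetSynthesis r).toContinuousLinearMap = 0 := by
    refine ContinuousLinearMap.ext_on dense_span_e ?_
    rintro _ ⟨j, rfl⟩
    simpa [hb.packetSynthesis_e] using h j
  exact congrArg (fun T : L2T →L[ℂ] ℂ => T g) this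

theorem inner_packetSynthesis_of_ne (hb : IsTranslateBasis φ) {r s : ℕ} (hrs : r ≠ s)
    (f g : L2T) : ⟪hb.packetSynthesis r f, hb.packetSynthesis s g⟫_ℂ = 0 := by
  refine hb.inner_packetSynthesis_eq_zero (fun j => ?_) g
  rw [← inner_conj_symm, hb.inner_packetSynthesis_eq_zero (fun l => ?_) f, map_zero]
  exact hb.orthonormal.2 (i := (s, j)) (j := (r, l)) fun h => hrs (Prod.ext_iff.1 h).1.symm

theorem eq_zero_of_inner_packetSynthesis (hb : IsTranslateBasis φ) {y : L2R}
    (h : ∀ r g, ⟪y, hb.packetSynthesis r g⟫_ℂ = 0) : y = 0 := by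
  have hd : Dense (Submodule.span ℂ
      (range fun q : ℕ × ℤ => translate q.2 (φ q.1)) : Set L2R) :=
    Submodule.dense_iff_topologicalClosure_eq_top.2 hb.total
  have : innerSL ℂ y = 0 := by
    refine ContinuousLinearMap.ext_on hd ?_
    rintro _ ⟨⟨r, j⟩, rfl⟩
    simpa [hb.packetSynthesis_e] using h r (e j)
  exact inner_self_eq_zero.1 (congrArg (fun T : L2R →L[ℂ] ℂ => T y) this)

/-- `W_{2n+i} = U W_n S_i`. -/
theorem packetSynthesis_eq_dilation (hb : IsTranslateBasis φ) (hφ : IsPacketSequence m φ)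
    (r : ℕ) (g : L2T) :
    hb.packetSynthesis r g =
      dilation (hb.packetSynthesis (r / 2) (m.S (Fin.ofNat 2 r) g)) := by
  rcases Nat.even_or_odd' r with ⟨n, rfl | rfl⟩
  · have h1 : 2 * n / 2 = n := by omega
    have h2 : Fin.ofNat 2 (2 * n) = 0 := by ext; simp
    rw [h1, h2]
    exact synthesis_eq_dilation _ _ _ _ _ _ (hφ.even n) g
  · have h1 : (2 * n + 1) / 2 = n := by omega
    have h2 : Fin.ofNat 2 (2 * n + 1) = 1 := by ext; simp
    rw [h1, h2]
    exact synthesis_eq_dilation _ _ _ _ _ _ (hφ.odd n) g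

theorem packetSynthesis_val (hb : IsTranslateBasis φ) (hφ : IsPacketSequence m φ)
    (i : Fin 2) (g : L2T) :
    hb.packetSynthesis i g = dilation (hb.packetSynthesis 0 (m.S i g)) := by
  have h1 : (i : ℕ) / 2 = 0 := by omega
  have h2 : Fin.ofNat 2 (i : ℕ) = i := by ext; simp
  rw [hb.packetSynthesis_eq_dilation hφ, h1, h2]

/-- In `W_i = U W_0 S_i` every other factor is an isometry. -/
theorem norm_S_apply (hb : IsTranslateBasis φ) (hφ : IsPacketSequence m φ) (i : Fin 2)
    (g : L2T) : ‖m.S i g‖ = ‖g‖ := by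
  rw [← (hb.packetSynthesis i).norm_map g, hb.packetSynthesis_val hφ, LinearIsometry.norm_map,
    LinearIsometry.norm_map]

theorem inner_S_of_ne (hb : IsTranslateBasis φ) (hφ : IsPacketSequence m φ) {i j : Fin 2}
    (hij : i ≠ j) (f g : L2T) : ⟪m.S i f, m.S j g⟫_ℂ = 0 := by
  rw [← (hb.packetSynthesis 0).inner_map_map, ← dilation.inner_map_map,
    ← hb.packetSynthesis_val hφ, ← hb.packetSynthesis_val hφ]
  exact hb.inner_packetSynthesis_of_ne (fun h => hij (Fin.ext h)) f g

/-- `U W_0 f` is orthogonal to every `W_r g = U W_{r/2} S_{r mod 2} g`: for `r ≤ 1` by the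
hypothesis, otherwise because `W_{r/2}` and `W_0` have orthogonal ranges. Totality then gives `f =
0`. -/
theorem eq_zero_of_adjoint_S (hb : IsTranslateBasis φ) (hφ : IsPacketSequence m φ) {f : L2T}
    (h : ∀ i, adjoint (m.S i) f = 0) : f = 0 := by
  have key : dilation (hb.packetSynthesis 0 f) = 0 := by
    refine hb.eq_zero_of_inner_packetSynthesis fun r g => ?_
    rw [hb.packetSynthesis_eq_dilation hφ r, dilation.inner_map_map]
    by_cases hr : r / 2 = 0
    · rw [hr, LinearIsometry.inner_map_map, ← adjoint_inner_left, h, inner_zero_left]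
    · exact hb.inner_packetSynthesis_of_ne (Ne.symm hr) _ _
  rw [← norm_eq_zero] at key ⊢
  simpa using key

theorem S_mul_adjoint_add (hb : IsTranslateBasis φ) (hφ : IsPacketSequence m φ) (f : L2T) :
    m.S 0 (adjoint (m.S 0) f) + m.S 1 (adjoint (m.S 1) f) = f := by
  have hself : ∀ i g, adjoint (m.S i) (m.S i g) = g := fun i g =>
    congrArg (fun T : L2T →L[ℂ] L2T => T g) (adjoint_mul_self_of_norm (hb.norm_S_apply hφ i))
  have hne : ∀ i j, i ≠ j → ∀ g, adjoint (m.S i) (m.S j g) = 0 := fun i j hij g => by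
    rw [← inner_self_eq_zero (𝕜 := ℂ), adjoint_inner_right]
    exact hb.inner_S_of_ne hφ hij _ _
  rw [← sub_eq_zero]
  refine hb.eq_zero_of_adjoint_S hφ fun i => ?_
  fin_cases i
  · simp [hself, hne 0 1 (by decide)]
  · simp [hself, hne 1 0 (by decide)]

theorem norm_adjoint_S_sq_add (hb : IsTranslateBasis φ) (hφ : IsPacketSequence m φ) (f : L2T) :
    ‖adjoint (m.S 0) f‖ ^ 2 + ‖adjoint (m.S 1) f‖ ^ 2 = ‖f‖ ^ 2 := by
  conv_rhs => rw [← hb.S_mul_adjoint_add hφ f]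
  rw [@norm_add_sq ℂ, hb.inner_S_of_ne hφ (by decide), hb.norm_S_apply hφ, hb.norm_S_apply hφ]
  simp

/-- Each step cancels one dilation on both sides and moves the last digit of `r` into the word; at
`p = 0` the packet is `W_n e_k`. -/
theorem inner_packetSynthesis_packet (hb : IsTranslateBasis φ) (hφ : IsPacketSequence m φ)
    (p n r : ℕ) (k : ℤ) (g : L2T) :
    ⟪hb.packetSynthesis r g, packet p k (φ n)⟫_ℂ = ⟪branch m.S n p r g, e k⟫_ℂ := by
  induction p generalizing r g with
  | zero =>
    rw [packet_zero, ← hb.packetSynthesis_e, branch]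
    split_ifs with h
    · rw [h, LinearIsometry.inner_map_map, one_apply_eq_self]
    · rw [hb.inner_packetSynthesis_of_ne h]; simp
  | succ p ih =>
    rw [packet_succ, hb.packetSynthesis_eq_dilation hφ, dilation.inner_map_map, ih, branch,
      mul_apply_eq_comp]

theorem hasSum_packetDistribution_section (hb : IsTranslateBasis φ) (hφ : IsPacketSequence m φ)
    (p n r : ℕ) (k : ℤ) :
    HasSum (fun j : ℤ => packetDistribution φ (packet p k (φ n)) (r, j))
      (‖adjoint (branch m.S n p r) (e k)‖ ^ 2) := by
  refine (hasSum_norm_inner_e_sq _).congr_fun fun j => ?_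
  rw [packetDistribution, ← hb.packetSynthesis_e, hb.inner_packetSynthesis_packet hφ,
    adjoint_inner_right]

theorem norm_packet (hb : IsTranslateBasis φ) (p n : ℕ) (k : ℤ) : ‖packet p k (φ n)‖ = 1 := by
  induction p with
  | zero => rw [packet_zero]; exact hb.orthonormal.1 (n, k)
  | succ p ih => rw [packet_succ, LinearIsometry.norm_map, ih]

theorem hasSum_packetDistribution (hb : IsTranslateBasis φ) (f : L2R) :
    HasSum (packetDistribution φ f) (‖f‖ ^ 2) := by
  have h := hasSum_norm_inner_sq (HilbertBasis.mk hb.orthonormal hb.total.ge) f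
  rw [HilbertBasis.coe_mk] at h
  exact h

end IsTranslateBasis
end PacketOperators

/-! ### Isometries without unitary part -/

section PureIsometry

open ContinuousLinearMap

variable {H : Type*} [NormedAddCommGroup H] [InnerProductSpace ℂ H]

theorem norm_pow_apply {A : H →L[ℂ] H} (hA : ∀ f, ‖A f‖ = ‖f‖) (p : ℕ) (f : H) :
    ‖(A ^ p) f‖ = ‖f‖ := by
  induction p with
  | zero => simp
  | succ p ih => rw [pow_succ', mul_apply_eq_comp, hA, ih]

variable [CompleteSpace H]

/-- An isometry without unitary part is pure: the powers of its adjoint tend strongly to `0`. -/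
theorem tendsto_adjoint_pow {A : H →L[ℂ] H} (hA : ∀ f, ‖A f‖ = ‖f‖)
    (h : ∀ g, (∀ p : ℕ, ∃ y, g = (A ^ p) y) → g = 0) (f : H) :
    Tendsto (fun r : ℕ => (adjoint A ^ r) f) atTop (𝓝 0) := by
  have hadj : ∀ p : ℕ, adjoint (A ^ p) = adjoint A ^ p := fun p => star_pow A p
  have hiso : ∀ p : ℕ, adjoint A ^ p * A ^ p = 1 := fun p => by
    rw [← hadj]; exact adjoint_mul_self_of_norm (norm_pow_apply hA p)
  -- `Q p` is the projection onto the range of `A^p`. These ranges decrease, so the vectors `Q p f`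
  -- converge, and their limit lies in every range.
  set Q : ℕ → H →L[ℂ] H := fun p => A ^ p * adjoint A ^ p with hQdef
  have hQ : ∀ p, IsStarProjection (Q p) := fun p => by
    have := isStarProjection_mul_adjoint (norm_pow_apply hA p)
    rwa [hadj] at this
  have hQQ : ∀ p r, Q p * Q (p + r) = Q (p + r) := fun p r => by
    simp only [hQdef]
    calc A ^ p * adjoint A ^ p * (A ^ (p + r) * adjoint A ^ (p + r))
        = A ^ p * (adjoint A ^ p * A ^ p) * A ^ r * adjoint A ^ (p + r) := by
          rw [pow_add A]; simp only [mul_assoc]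
      _ = _ := by rw [hiso, mul_one, ← pow_add]
  have hQQ' : ∀ p r, Q (p + r) * Q p = Q (p + r) := fun p r => by
    have h1 := congrArg star (hQQ p r)
    rwa [star_mul, (hQ p).isSelfAdjoint.star_eq, (hQ (p + r)).isSelfAdjoint.star_eq] at h1
  have hnorm : ∀ p, ‖Q p f‖ = ‖(adjoint A ^ p) f‖ := fun p => by
    simp only [hQdef, mul_apply_eq_comp, norm_pow_apply hA]
  have hdiff : ∀ p r, ‖Q p f - Q (p + r) f‖ ^ 2 = ‖Q p f‖ ^ 2 - ‖Q (p + r) f‖ ^ 2 := fun p r => by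
    have h1 := norm_sq_one_sub_apply (hQ (p + r)) (Q p f)
    have h2 : Q (p + r) (Q p f) = Q (p + r) f :=
      congrArg (fun T : H →L[ℂ] H => T f) (hQQ' p r)
    rw [sub_apply, one_apply_eq_self, h2] at h1
    exact h1
  have hanti : Antitone fun p => ‖Q p f‖ ^ 2 := antitone_nat_of_succ_le fun p => by
    have := hdiff p 1
    nlinarith [sq_nonneg ‖Q p f - Q (p + 1) f‖]
  obtain ⟨l, hl⟩ : ∃ l, Tendsto (fun p => ‖Q p f‖ ^ 2) atTop (𝓝 l) :=
    ⟨_, tendsto_atTop_ciInf hanti ⟨0, by rintro _ ⟨p, rfl⟩; exact sq_nonneg _⟩⟩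
  -- By Pythagoras, squared distances are differences of the convergent decreasing sequence `‖Q p
  -- f‖²`.
  have hcauchy : CauchySeq fun p => Q p f := by
    have hle : ∀ N n r, N ≤ n → dist (Q n f) (Q (n + r) f) ≤ √(‖Q N f‖ ^ 2 - l) := by
      intro N n r hn
      rw [dist_eq_norm]
      refine Real.le_sqrt_of_sq_le ?_
      rw [hdiff]
      exact sub_le_sub (hanti hn) (hanti.le_of_tendsto hl _)
    refine cauchySeq_of_le_tendsto_0 (fun N => √(‖Q N f‖ ^ 2 - l)) (fun n k N hn hk => ?_) ?_
    · rcases le_total n k with hnk | hnk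
      · obtain ⟨r, rfl⟩ := Nat.exists_eq_add_of_le hnk
        exact hle N n r hn
      · obtain ⟨r, rfl⟩ := Nat.exists_eq_add_of_le hnk
        rw [dist_comm]
        exact hle N k r hk
    · have := (hl.sub_const l).sqrt
      rwa [sub_self, Real.sqrt_zero] at this
  obtain ⟨g, hg⟩ := cauchySeq_tendsto_of_complete hcauchy
  have hfix : ∀ p, Q p g = g := fun p => by
    have h1 : Tendsto (fun r => Q p (Q (r + p) f)) atTop (𝓝 (Q p g)) :=
      ((Q p).continuous.tendsto g).comp ((tendsto_add_atTop_iff_nat p).2 hg)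
    refine tendsto_nhds_unique h1 (((tendsto_add_atTop_iff_nat p).2 hg).congr fun r => ?_)
    rw [add_comm r p]
    exact (congrArg (fun T : H →L[ℂ] H => T f) (hQQ p r)).symm
  have hg0 : g = 0 := h g fun p => ⟨(adjoint A ^ p) g, (hfix p).symm⟩
  rw [tendsto_zero_iff_norm_tendsto_zero]
  refine (tendsto_zero_iff_norm_tendsto_zero.1 (hg0 ▸ hg)).congr hnorm

end PureIsometry

/-! ### Mixing of the doubling map -/

section Mixing

theorem measurePreserving_two_pow (p : ℕ) :
    MeasurePreserving (fun x : UnitAddCircle => (2 ^ p : ℕ) • x)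
      AddCircle.haarAddCircle AddCircle.haarAddCircle := by
  induction p with
  | zero =>
    simp only [pow_zero, one_smul]
    exact MeasurePreserving.id _
  | succ p ih =>
    have := measurePreserving_double.comp ih
    simpa only [Function.comp_def, smul_smul, pow_succ', mul_comm] using this

theorem integral_comp_two_pow {E : Type*} [NormedAddCommGroup E] [NormedSpace ℝ E] (p : ℕ)
    {G : UnitAddCircle → E} (hG : AEStronglyMeasurable G AddCircle.haarAddCircle) :
    ∫ x, G ((2 ^ p : ℕ) • x) ∂AddCircle.haarAddCircle = ∫ x, G x ∂AddCircle.haarAddCircle := by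
  have hp := measurePreserving_two_pow p
  conv_rhs => rw [← hp.map_eq]
  rw [integral_map hp.measurable.aemeasurable (by rwa [hp.map_eq])]

/-- Translation by `2^{-p}` fixes `a(2^p x)` and multiplies the character by a root of unity,
different from `1` because `0 < |n| < 2^p`. -/
theorem integral_mul_fourier_eq_zero (a : UnitAddCircle → ℂ) {p : ℕ} {n : ℤ} (hn : n ≠ 0)
    (hp : |n| < 2 ^ p) :
    ∫ x, a ((2 ^ p : ℕ) • x) * fourier (T := 1) n x ∂AddCircle.haarAddCircle = 0 := by
  set s : UnitAddCircle := (((2 ^ p)⁻¹ : ℝ) : UnitAddCircle) with hs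
  have hs1 : (2 ^ p : ℕ) • s = 0 := by
    rw [hs, ← AddCircle.coe_nsmul, AddCircle.coe_eq_zero_iff]
    refine ⟨1, ?_⟩
    simp
  have hf : ∀ x, fourier (T := 1) n (x + s) = fourier (T := 1) n s * fourier (T := 1) n x := by
    intro x
    simp only [fourier_apply, smul_add, AddCircle.toCircle_add, Circle.coe_mul, mul_comm]
  have hne : fourier (T := 1) n s ≠ 1 := by
    rw [hs, fourier_coe_apply, Ne, Complex.exp_eq_one_iff]
    rintro ⟨k, hk⟩
    rw [Complex.ofReal_one, div_one] at hk
    have h2 : (2 : ℂ) * Real.pi * Complex.I ≠ 0 := by simp [Real.pi_ne_zero]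
    have h3 : (n : ℂ) * ((2 ^ p : ℝ)⁻¹ : ℝ) = k := by
      refine mul_left_cancel₀ h2 ?_
      linear_combination hk
    have h4 : (n : ℂ) = k * 2 ^ p := by
      rw [← h3]; push_cast; field_simp
    have h5 : n = k * 2 ^ p := by exact_mod_cast h4
    have hk0 : k ≠ 0 := by rintro rfl; simp at h5; exact hn h5
    rw [h5, abs_mul, abs_of_pos (by positivity : (0 : ℤ) < 2 ^ p)] at hp
    have : 1 ≤ |k| := Int.one_le_abs hk0
    nlinarith [(by positivity : (0 : ℤ) < 2 ^ p)]
  have h := integral_add_right_eq_self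
    (fun x => a ((2 ^ p : ℕ) • x) * fourier (T := 1) n x) s (μ := AddCircle.haarAddCircle)
  have h2 : ∀ x, a ((2 ^ p : ℕ) • (x + s)) * fourier (T := 1) n (x + s) =
      fourier (T := 1) n s * (a ((2 ^ p : ℕ) • x) * fourier (T := 1) n x) := fun x => by
    rw [smul_add, hs1, add_zero, hf]; ring
  simp only [h2] at h
  rw [integral_const_mul] at h
  have h3 : (fourier (T := 1) n s - 1) *
      ∫ x, a ((2 ^ p : ℕ) • x) * fourier (T := 1) n x ∂AddCircle.haarAddCircle = 0 := by
    rw [sub_mul, one_mul, h, sub_self]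
  exact (mul_eq_zero.1 h3).resolve_left (sub_ne_zero.2 hne)

theorem tendsto_integral_mul_fourier {a : UnitAddCircle → ℂ} (ha : Measurable a) (n : ℤ) :
    Tendsto (fun p : ℕ => ∫ x, a ((2 ^ p : ℕ) • x) * fourier (T := 1) n x ∂AddCircle.haarAddCircle)
      atTop (𝓝 ((∫ x, a x ∂AddCircle.haarAddCircle) *
        ∫ x, fourier (T := 1) n x ∂AddCircle.haarAddCircle)) := by
  by_cases hn : n = 0
  · subst hn
    simp only [fourier_zero, mul_one]
    simp only [integral_comp_two_pow _ ha.aestronglyMeasurable]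
    simp
  · have h0 : ∫ x, fourier (T := 1) n x ∂AddCircle.haarAddCircle = 0 := by
      obtain ⟨p, hp⟩ := pow_unbounded_of_one_lt |n| (by norm_num : (1 : ℤ) < 2)
      simpa using integral_mul_fourier_eq_zero (fun _ => 1) hn hp
    rw [h0, mul_zero]
    obtain ⟨p, hp⟩ := pow_unbounded_of_one_lt |n| (by norm_num : (1 : ℤ) < 2)
    refine tendsto_const_nhds.congr' ?_
    filter_upwards [eventually_ge_atTop p] with q hq
    refine (integral_mul_fourier_eq_zero a hn (hp.trans_le ?_)).symm
    exact pow_le_pow_right₀ (by norm_num) hq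

/-- The doubling map is mixing. -/
theorem tendsto_integral_comp_two_pow_mul {a : UnitAddCircle → ℂ} (ha : Measurable a) {C : ℝ}
    (hC : ∀ x, ‖a x‖ ≤ C) {F : UnitAddCircle → ℂ} (hF : Integrable F AddCircle.haarAddCircle) :
    Tendsto (fun p : ℕ => ∫ x, a ((2 ^ p : ℕ) • x) * F x ∂AddCircle.haarAddCircle) atTop
      (𝓝 ((∫ x, a x ∂AddCircle.haarAddCircle) * ∫ x, F x ∂AddCircle.haarAddCircle)) := by
  have hC0 : 0 ≤ C := (norm_nonneg _).trans (hC 0)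
  have hmeas : ∀ p : ℕ, Measurable fun x : UnitAddCircle => a ((2 ^ p : ℕ) • x) := fun p =>
    ha.comp (measurePreserving_two_pow p).measurable
  have hint : ∀ (p : ℕ) {F : UnitAddCircle → ℂ}, Integrable F AddCircle.haarAddCircle →
      Integrable (fun x => a ((2 ^ p : ℕ) • x) * F x) AddCircle.haarAddCircle := fun p F hF =>
    hF.bdd_mul (hmeas p).aestronglyMeasurable (Eventually.of_forall fun x => hC _)
  have hconst : ‖∫ x, a x ∂AddCircle.haarAddCircle‖ ≤ C := by
    simpa using norm_integral_le_of_norm_le_const (μ := AddCircle.haarAddCircle)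
      (Eventually.of_forall hC)
  -- The mixing error is linear in `F` and bounded on `L¹` uniformly in `p`. The functions along
  -- which it tends to `0` thus form a closed subspace, and it contains the characters.
  let L : ℕ → Lp ℂ 1 (AddCircle.haarAddCircle (T := 1)) → ℂ := fun p F =>
    ∫ x, a ((2 ^ p : ℕ) • x) * F x ∂AddCircle.haarAddCircle -
      (∫ x, a x ∂AddCircle.haarAddCircle) * ∫ x, F x ∂AddCircle.haarAddCircle
  have hI : ∀ F : Lp ℂ 1 (AddCircle.haarAddCircle (T := 1)), Integrable F AddCircle.haarAddCircle :=
    fun F => L1.integrable_coeFn F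
  have hadd : ∀ p F G, L p (F + G) = L p F + L p G := fun p F G => by
    simp only [L]
    rw [integral_congr_ae (Lp.coeFn_add F G)]
    have h1 : ∫ x, a ((2 ^ p : ℕ) • x) *
          (F + G : Lp ℂ 1 (AddCircle.haarAddCircle (T := 1))) x ∂AddCircle.haarAddCircle =
        ∫ x, (a ((2 ^ p : ℕ) • x) * F x + a ((2 ^ p : ℕ) • x) * G x) ∂AddCircle.haarAddCircle := by
      refine integral_congr_ae ?_
      filter_upwards [Lp.coeFn_add F G] with x hx
      rw [hx, Pi.add_apply, mul_add]
    rw [h1, integral_add (hint p (hI F)) (hint p (hI G))]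
    simp only [Pi.add_apply]
    rw [integral_add (hI F) (hI G)]
    ring
  have hsmul : ∀ p (c : ℂ) F, L p (c • F) = c * L p F := fun p c F => by
    simp only [L]
    rw [integral_congr_ae (Lp.coeFn_smul c F)]
    have h1 : ∫ x, a ((2 ^ p : ℕ) • x) *
          (c • F : Lp ℂ 1 (AddCircle.haarAddCircle (T := 1))) x ∂AddCircle.haarAddCircle =
        ∫ x, c * (a ((2 ^ p : ℕ) • x) * F x) ∂AddCircle.haarAddCircle := by
      refine integral_congr_ae ?_
      filter_upwards [Lp.coeFn_smul c F] with x hx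
      rw [hx, Pi.smul_apply, smul_eq_mul]; ring
    rw [h1, integral_const_mul]
    simp only [Pi.smul_apply, smul_eq_mul]
    rw [integral_const_mul]
    ring
  have hbound : ∀ p F, ‖L p F‖ ≤ 2 * C * ‖F‖ := fun p F => by
    have hFn : ‖F‖ = ∫ x, ‖F x‖ ∂AddCircle.haarAddCircle := L1.norm_eq_integral_norm F
    have h1 : ‖∫ x, a ((2 ^ p : ℕ) • x) * F x ∂AddCircle.haarAddCircle‖ ≤ C * ‖F‖ := by
      rw [hFn, ← integral_const_mul]
      refine norm_integral_le_of_norm_le ((hI F).norm.const_mul C)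
        (Eventually.of_forall fun x => ?_)
      rw [norm_mul]
      exact mul_le_mul_of_nonneg_right (hC _) (norm_nonneg _)
    have h2 : ‖(∫ x, a x ∂AddCircle.haarAddCircle) * ∫ x, F x ∂AddCircle.haarAddCircle‖ ≤
        C * ‖F‖ := by
      rw [norm_mul, hFn]
      exact mul_le_mul hconst (norm_integral_le_integral_norm _) (norm_nonneg _) hC0
    calc ‖L p F‖ ≤ _ := norm_sub_le _ _
      _ ≤ 2 * C * ‖F‖ := by linarith
  let K : Submodule ℂ (Lp ℂ 1 (AddCircle.haarAddCircle (T := 1))) :=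
    { carrier := {F | Tendsto (fun p => L p F) atTop (𝓝 0)}
      zero_mem' := by
        have h0 : ∀ p, L p 0 = 0 := fun p => by
          have := hsmul p 0 0
          rwa [zero_smul, zero_mul] at this
        simp only [Set.mem_ofPred_eq, h0]
        exact tendsto_const_nhds
      add_mem' := fun {F G} hF hG => by
        simp only [Set.mem_ofPred_eq, hadd] at *
        simpa using hF.add hG
      smul_mem' := fun c F hF => by
        simp only [Set.mem_ofPred_eq, hsmul] at *
        simpa using hF.const_mul c }
  have hclosed : IsClosed (K : Set (Lp ℂ 1 (AddCircle.haarAddCircle (T := 1)))) := by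
    rw [← isSeqClosed_iff_isClosed]
    intro F G hF hFG
    change Tendsto (fun p => L p G) atTop (𝓝 0)
    rw [Metric.tendsto_atTop]
    intro ε hε
    -- With this tolerance the uniform bound `2C` leaves at most `ε/2`; the `+ 1` covers `C = 0`.
    obtain ⟨N, hN⟩ := Metric.tendsto_atTop.1 hFG (ε / (2 * (2 * C + 1))) (by positivity)
    obtain ⟨P, hP⟩ := Metric.tendsto_atTop.1 (hF N) (ε / 2) (by positivity)
    refine ⟨P, fun p hp => ?_⟩
    have h1 : L p G = L p (F N) + L p (G - F N) := by rw [← hadd]; simp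
    have h2 := hP p hp
    have h3 := hN N le_rfl
    rw [dist_comm, dist_eq_norm, lt_div_iff₀ (by positivity)] at h3
    rw [dist_zero_right] at h2 ⊢
    have h4 := hbound p (G - F N)
    have h5 : ‖L p G‖ ≤ ‖L p (F N)‖ + ‖L p (G - F N)‖ := h1 ▸ norm_add_le _ _
    nlinarith [norm_nonneg (G - F N)]
  have hle : (Submodule.span ℂ (range (fourierLp (T := 1) 1))).topologicalClosure ≤ K := by
    refine Submodule.topologicalClosure_minimal _ (Submodule.span_le.2 ?_) hclosed
    rintro _ ⟨n, rfl⟩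
    change Tendsto (fun p => L p _) atTop (𝓝 0)
    have h1 : ∀ p, L p (fourierLp (T := 1) 1 n) =
        ∫ x, a ((2 ^ p : ℕ) • x) * fourier (T := 1) n x ∂AddCircle.haarAddCircle -
          (∫ x, a x ∂AddCircle.haarAddCircle) *
            ∫ x, fourier (T := 1) n x ∂AddCircle.haarAddCircle :=
      fun p => by
      simp only [L]
      rw [integral_congr_ae (coeFn_fourierLp 1 n)]
      congr 1
      refine integral_congr_ae ?_
      filter_upwards [coeFn_fourierLp (T := 1) 1 n] with x hx
      rw [hx]
    simp only [h1]
    rw [← sub_self ((∫ x, a x ∂AddCircle.haarAddCircle) *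
      ∫ x, fourier (T := 1) n x ∂AddCircle.haarAddCircle)]
    exact (tendsto_integral_mul_fourier ha n).sub_const _
  rw [span_fourierLp_closure_eq_top (by simp)] at hle
  have hmem : Tendsto (fun p => L p hF.toL1) atTop (𝓝 0) := hle Submodule.mem_top
  have hL : ∀ p, L p hF.toL1 =
      ∫ x, a ((2 ^ p : ℕ) • x) * F x ∂AddCircle.haarAddCircle -
        (∫ x, a x ∂AddCircle.haarAddCircle) * ∫ x, F x ∂AddCircle.haarAddCircle := fun p => by
    simp only [L]
    rw [integral_congr_ae hF.coeFn_toL1]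
    congr 1
    refine integral_congr_ae ?_
    filter_upwards [hF.coeFn_toL1] with x hx
    rw [hx]
  simp only [hL] at hmem
  exact tendsto_sub_nhds_zero_iff.1 hmem

end Mixing

/-! ### The high-pass isometry is pure -/

section HighPass

open ContinuousLinearMap

variable (m : QMF)

theorem toCircle_add_half (x : UnitAddCircle) :
    AddCircle.toCircle (x + ((1 / 2 : ℝ) : UnitAddCircle)) = -AddCircle.toCircle x := by
  rw [AddCircle.toCircle_add, AddCircle.toCircle_apply_mk]
  have : Circle.exp (2 * Real.pi / 1 * (1 / 2)) = -1 := by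
    have h : 2 * Real.pi / 1 * (1 / 2) = Real.pi := by ring
    rw [h]
    ext
    simp
  rw [this, mul_neg, mul_one]

theorem integral_eq_zero_of_odd {o : UnitAddCircle → ℝ}
    (ho : ∀ x, o (x + ((1 / 2 : ℝ) : UnitAddCircle)) = -o x) :
    ∫ x, o x ∂AddCircle.haarAddCircle = 0 := by
  have h := integral_add_right_eq_self o ((1 / 2 : ℝ) : UnitAddCircle)
    (μ := AddCircle.haarAddCircle)
  simp only [ho, integral_neg] at h
  linarith

theorem two_nsmul_add_half (x : UnitAddCircle) :
    (2 : ℕ) • (x + ((1 / 2 : ℝ) : UnitAddCircle)) = (2 : ℕ) • x := by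
  have : (2 : ℕ) • ((1 / 2 : ℝ) : UnitAddCircle) = 0 := by
    rw [← AddCircle.coe_nsmul, AddCircle.coe_eq_zero_iff]
    exact ⟨1, by simp⟩
  rw [smul_add, this, add_zero]

namespace QMF

/-- The deviation `|m₁|² - 1` of the high-pass function from being unimodular. -/
noncomputable def dev (x : UnitAddCircle) : ℝ := ‖m.high (AddCircle.toCircle x)‖ ^ 2 - 1

theorem norm_high (z : Circle) : ‖m.high z‖ = ‖m.low (-z)‖ := by
  rw [high, norm_mul, Circle.norm_coe, one_mul, RCLike.norm_conj]

theorem dev_add_half (x : UnitAddCircle) :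
    m.dev (x + ((1 / 2 : ℝ) : UnitAddCircle)) = -m.dev x := by
  have h := m.norm_sq_add (AddCircle.toCircle x)
  rw [dev, dev, m.norm_high, m.norm_high, toCircle_add_half, neg_neg]
  linarith

theorem norm_sq_low (x : UnitAddCircle) : ‖m.low (AddCircle.toCircle x)‖ ^ 2 = 1 - m.dev x := by
  have h := m.norm_sq_add (AddCircle.toCircle x)
  rw [dev, m.norm_high]
  linarith

theorem measurable_dev : Measurable m.dev :=
  ((m.measurable_high.comp AddCircle.continuous_toCircle.measurable).norm.pow_const 2).sub_const 1

theorem abs_dev_le (x : UnitAddCircle) : |m.dev x| ≤ 1 := by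
  have h := m.norm_sq_low x
  have h1 : 0 ≤ m.dev x + 1 := by rw [dev]; simp
  rw [abs_le]
  constructor <;> nlinarith [sq_nonneg ‖m.low (AddCircle.toCircle x)‖]

theorem integrable_norm_sq (f : L2T) :
    Integrable (fun x => ‖f x‖ ^ 2) AddCircle.haarAddCircle :=
  (Lp.memLp f).norm.integrable_sq

theorem norm_sq_S_one (f : L2T) :
    (fun x => ‖m.S 1 f x‖ ^ 2) =ᵐ[AddCircle.haarAddCircle]
      fun x => (1 + m.dev x) * ‖f ((2 : ℕ) • x)‖ ^ 2 := by
  filter_upwards [filterOp_apply m.high m.measurable_high (√2) m.norm_high_le f] with x hx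
  change ‖filterOp m.high m.measurable_high (√2) m.norm_high_le f x‖ ^ 2 = _
  rw [hx, norm_mul, mul_pow, dev]
  ring

/-- `|m_1|² = 1 + dev`, where `dev` is odd under the half-period shift and functions of `2x` are
invariant; the odd part integrates to `0`. -/
theorem integral_mul_norm_sq_S_one {a : UnitAddCircle → ℝ} (ha : Measurable a) {C : ℝ}
    (hC : ∀ x, ‖a x‖ ≤ C) (f : L2T) :
    ∫ x, a ((2 : ℕ) • x) * ‖m.S 1 f x‖ ^ 2 ∂AddCircle.haarAddCircle =
      ∫ x, a x * ‖f x‖ ^ 2 ∂AddCircle.haarAddCircle := by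
  set G : UnitAddCircle → ℝ := fun x => a x * ‖f x‖ ^ 2 with hG
  have hGint : Integrable G AddCircle.haarAddCircle :=
    (integrable_norm_sq f).bdd_mul ha.aestronglyMeasurable (Eventually.of_forall hC)
  have hG2 : Integrable (fun x => G ((2 : ℕ) • x)) AddCircle.haarAddCircle :=
    
    (measurePreserving_double.integrable_comp hGint.aestronglyMeasurable).2 hGint
  have h1 : ∫ x, a ((2 : ℕ) • x) * ‖m.S 1 f x‖ ^ 2 ∂AddCircle.haarAddCircle =
      ∫ x, (G ((2 : ℕ) • x) + m.dev x * G ((2 : ℕ) • x)) ∂AddCircle.haarAddCircle := by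
    refine integral_congr_ae ?_
    filter_upwards [m.norm_sq_S_one f] with x hx
    rw [hx, hG]; ring
  have hodd : ∫ x, m.dev x * G ((2 : ℕ) • x) ∂AddCircle.haarAddCircle = 0 :=
    integral_eq_zero_of_odd fun x => by rw [m.dev_add_half, two_nsmul_add_half]; ring
  rw [h1, integral_add hG2 (hG2.bdd_mul m.measurable_dev.aestronglyMeasurable
    (Eventually.of_forall m.abs_dev_le)), hodd, add_zero]
  simpa using integral_comp_two_pow 1 hGint.aestronglyMeasurable

/-- With `d = dev`, the weight is chosen so that `(d² - d)(1 + d) = d³ - d` is odd, while `d² - d`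
itself has integral `∫ d²`. -/
theorem integral_dev_mul_norm_sq_S_one (f : L2T) :
    ∫ x, (m.dev x ^ 2 - m.dev x) * ‖m.S 1 f x‖ ^ 2 ∂AddCircle.haarAddCircle = 0 := by
  have h1 : ∫ x, (m.dev x ^ 2 - m.dev x) * ‖m.S 1 f x‖ ^ 2 ∂AddCircle.haarAddCircle =
      ∫ x, (m.dev x ^ 3 - m.dev x) * ‖f ((2 : ℕ) • x)‖ ^ 2 ∂AddCircle.haarAddCircle := by
    refine integral_congr_ae ?_
    filter_upwards [m.norm_sq_S_one f] with x hx
    rw [hx]; ring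
  rw [h1]
  refine integral_eq_zero_of_odd fun x => ?_
  rw [m.dev_add_half, two_nsmul_add_half]; ring

theorem integral_mul_norm_sq_S_one_pow {a : UnitAddCircle → ℝ} (ha : Measurable a) {C : ℝ}
    (hC : ∀ x, ‖a x‖ ≤ C) (p : ℕ) (f : L2T) :
    ∫ x, a ((2 ^ p : ℕ) • x) * ‖(m.S 1 ^ p) f x‖ ^ 2 ∂AddCircle.haarAddCircle =
      ∫ x, a x * ‖f x‖ ^ 2 ∂AddCircle.haarAddCircle := by
  induction p with
  | zero => simp
  | succ p ih =>
    have h := m.integral_mul_norm_sq_S_one (a := fun x => a ((2 ^ p : ℕ) • x))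
      (ha.comp (measurePreserving_two_pow p).measurable) (fun x => hC _) ((m.S 1 ^ p) f)
    simp only [smul_smul, ← pow_succ] at h
    rw [← ih, ← h, pow_succ' (m.S 1), mul_apply_eq_comp]

/-- A nonzero vector in the range of all powers of `S_1` forces `|m₁| = 1`. -/
theorem dev_eq_zero_of_forall_range {f : L2T} (hf : f ≠ 0)
    (h : ∀ p : ℕ, ∃ g, f = (m.S 1 ^ p) g) :
    ∀ᵐ x ∂(AddCircle.haarAddCircle : Measure UnitAddCircle), m.dev x = 0 := by
  set w : UnitAddCircle → ℝ := fun x => m.dev x ^ 2 - m.dev x with hw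
  have hwm : Measurable w := (m.measurable_dev.pow_const 2).sub m.measurable_dev
  have hwC : ∀ x, ‖w x‖ ≤ 2 := fun x => by
    have h1 := m.abs_dev_le x
    have h2 := abs_le.1 h1
    rw [Real.norm_eq_abs, abs_le]
    constructor <;> simp only [hw] <;> nlinarith
  have hzero : ∀ p : ℕ,
      ∫ x, w ((2 ^ p : ℕ) • x) * ‖f x‖ ^ 2 ∂AddCircle.haarAddCircle = 0 := fun p => by
    -- Of the `p + 1` factors, `p` remove the dilation from `w(2^p x)`; the remaining one makes the
    -- integral against `w` vanish.
    obtain ⟨g, hg⟩ := h (p + 1)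
    rw [hg, pow_succ, mul_apply_eq_comp, m.integral_mul_norm_sq_S_one_pow hwm hwC]
    exact m.integral_dev_mul_norm_sq_S_one g
  have hF : Integrable (fun x => ((‖f x‖ ^ 2 : ℝ) : ℂ)) AddCircle.haarAddCircle :=
    (integrable_norm_sq f).ofReal (𝕜 := ℂ)
  have hmix := tendsto_integral_comp_two_pow_mul (a := fun x => (w x : ℂ))
    (Complex.measurable_ofReal.comp hwm) (C := 2) (fun x => by simpa using hwC x)
    hF
  have h1 : ∀ p : ℕ, ∫ x, (w ((2 ^ p : ℕ) • x) : ℂ) * ((‖f x‖ ^ 2 : ℝ) : ℂ)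
      ∂AddCircle.haarAddCircle = 0 := fun p => by
    simp only [← Complex.ofReal_mul]
    rw [integral_complex_ofReal, hzero, Complex.ofReal_zero]
  simp only [h1] at hmix
  -- The integrals are all `0`, but by mixing they tend to `(∫ w) ‖f‖²`; hence `∫ w = ∫ dev² = 0`.
  have h2 := tendsto_nhds_unique hmix tendsto_const_nhds
  rw [integral_complex_ofReal, integral_complex_ofReal, ← norm_sq_eq_integral,
    ← Complex.ofReal_mul] at h2
  have h3 : ∫ x, w x ∂AddCircle.haarAddCircle = 0 :=
    (mul_eq_zero.1 (Complex.ofReal_eq_zero.1 h2)).resolve_right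
      (pow_ne_zero 2 (norm_ne_zero_iff.2 hf))
  have hdint : Integrable m.dev AddCircle.haarAddCircle :=
    .of_bound m.measurable_dev.aestronglyMeasurable 1 (Eventually.of_forall m.abs_dev_le)
  have hd2int : Integrable (fun x => m.dev x ^ 2) AddCircle.haarAddCircle :=
    .of_bound (m.measurable_dev.pow_const 2).aestronglyMeasurable 1
      (Eventually.of_forall fun x => by
      rw [norm_pow]
      exact pow_le_one₀ (norm_nonneg _) (m.abs_dev_le x))
  rw [hw, integral_sub hd2int hdint, integral_eq_zero_of_odd m.dev_add_half, sub_zero,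
    integral_eq_zero_iff_of_nonneg (fun x => sq_nonneg _) hd2int] at h3
  filter_upwards [h3] with x hx
  exact pow_eq_zero_iff two_ne_zero |>.1 hx

end QMF

/-- An `L²` function with `|f(x)|² = |f(x/2)|² / 2` vanishes. -/
theorem eq_zero_of_norm_sq_half {f : L2R}
    (h : ∀ᵐ x : ℝ, ‖f x‖ ^ 2 = 2⁻¹ * ‖f (x / 2)‖ ^ 2) : f = 0 := by
  set G : ℝ → ℝ := fun x => ‖f x‖ ^ 2 with hG
  have hint : Integrable G := (Lp.memLp f).norm.integrable_sq
  -- The mass of `(-a, a)` is invariant under doubling `a`. Letting the intervals shrink gives `0`,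
  -- and letting them grow gives `‖f‖²`.
  have hdouble : ∀ a : ℝ, ∫ x in Ioo (-(2 * a)) (2 * a), G x = ∫ x in Ioo (-a) a, G x := by
    intro a
    rw [← integral_indicator measurableSet_Ioo, ← integral_indicator measurableSet_Ioo]
    have h1 : ∫ x, (Ioo (-(2 * a)) (2 * a)).indicator G x =
        ∫ x, 2⁻¹ * (Ioo (-a) a).indicator G (x / 2) := by
      refine integral_congr_ae ?_
      filter_upwards [h] with x hx
      by_cases hxa : x ∈ Ioo (-(2 * a)) (2 * a)
      · have : x / 2 ∈ Ioo (-a) a := ⟨by linarith [hxa.1], by linarith [hxa.2]⟩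
        rw [indicator_of_mem hxa, indicator_of_mem this]
        exact hx
      · have : x / 2 ∉ Ioo (-a) a := fun h' => hxa ⟨by linarith [h'.1], by linarith [h'.2]⟩
        rw [indicator_of_notMem hxa, indicator_of_notMem this, mul_zero]
    rw [h1, integral_const_mul, Measure.integral_comp_div]
    simp
  have hpos : ∀ k : ℕ, ∫ x in Ioo (-(2 ^ k : ℝ)) (2 ^ k), G x = ∫ x in Ioo (-1 : ℝ) 1, G x := by
    intro k
    induction k with
    | zero => simp
    | succ k ih => rw [← ih, pow_succ', hdouble]
  have hneg : ∀ k : ℕ, ∫ x in Ioo (-((1 / 2) ^ k : ℝ)) ((1 / 2) ^ k), G x =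
      ∫ x in Ioo (-1 : ℝ) 1, G x := by
    intro k
    induction k with
    | zero => simp
    | succ k ih =>
      rw [← ih, ← hdouble, pow_succ']
      congr 3 <;> ring
  have h0 : Tendsto (fun k : ℕ => ∫ x in Ioo (-((1 / 2) ^ k : ℝ)) ((1 / 2) ^ k), G x) atTop
      (𝓝 (∫ x in ⋂ k : ℕ, Ioo (-((1 / 2) ^ k : ℝ)) ((1 / 2) ^ k), G x)) := by
    refine tendsto_setIntegral_of_antitone (fun _ => measurableSet_Ioo) (fun a b hab => ?_)
      ⟨0, hint.integrableOn⟩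
    have : (1 / 2 : ℝ) ^ b ≤ (1 / 2) ^ a :=
      pow_le_pow_of_le_one (by norm_num) (by norm_num) hab
    exact Ioo_subset_Ioo (by linarith) this
  have hinter : (⋂ k : ℕ, Ioo (-((1 / 2) ^ k : ℝ)) ((1 / 2) ^ k)) ⊆ {0} := by
    intro x hx
    by_contra hne
    obtain ⟨k, hk⟩ := exists_pow_lt_of_lt_one (abs_pos.2 hne) (by norm_num : (1 / 2 : ℝ) < 1)
    have := mem_iInter.1 hx k
    exact absurd (abs_lt.2 ⟨this.1, this.2⟩) hk.not_gt
  have hI0 : ∫ x in ⋂ k : ℕ, Ioo (-((1 / 2) ^ k : ℝ)) ((1 / 2) ^ k), G x = 0 :=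
    setIntegral_measure_zero _ (measure_mono_null hinter (by simp))
  have h1 : Tendsto (fun k : ℕ => ∫ x in Ioo (-(2 ^ k : ℝ)) (2 ^ k), G x) atTop
      (𝓝 (∫ x in ⋃ k : ℕ, Ioo (-(2 ^ k : ℝ)) (2 ^ k), G x)) := by
    refine tendsto_setIntegral_of_monotone (fun _ => measurableSet_Ioo) (fun a b hab => ?_)
      hint.integrableOn
    have : (2 : ℝ) ^ a ≤ 2 ^ b := pow_le_pow_right₀ (by norm_num) hab
    exact Ioo_subset_Ioo (by linarith) this
  have hunion : (⋃ k : ℕ, Ioo (-(2 ^ k : ℝ)) (2 ^ k)) = univ := by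
    refine eq_univ_of_forall fun x => ?_
    obtain ⟨k, hk⟩ := pow_unbounded_of_one_lt |x| (by norm_num : (1 : ℝ) < 2)
    exact mem_iUnion.2 ⟨k, abs_lt.1 hk⟩
  simp only [hneg, hI0] at h0
  simp only [hpos, hunion, setIntegral_univ] at h1
  have h2 := tendsto_nhds_unique h0 tendsto_const_nhds
  have h3 := tendsto_nhds_unique h1 tendsto_const_nhds
  have h4 : ‖f‖ ^ 2 = 0 := by rw [norm_sq_eq_integral]; exact h3.trans h2.symm
  simpa using h4

/-- `S_1` has no unitary part if the wavelet packets are orthonormal. -/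
theorem IsTranslateBasis.tendsto_adjoint_S_one_pow {m : QMF} {φ : ℕ → L2R}
    (hb : IsTranslateBasis φ) (hφ : IsPacketSequence m φ) (f : L2T) :
    Tendsto (fun r : ℕ => (adjoint (m.S 1) ^ r) f) atTop (𝓝 0) := by
  refine tendsto_adjoint_pow (hb.norm_S_apply hφ 1) (fun g hg => ?_) f
  by_contra hne
  have hdev := m.dev_eq_zero_of_forall_range hne hg
  -- With `dev = 0` also `|m_0| = 1` a.e., and the even packet equation at `n = 0` becomes the
  -- scaling relation for `|φ̂_0|²`.
  have hzero : (𝓕 (φ 0) : L2R) = 0 := by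
    refine eq_zero_of_norm_sq_half ?_
    filter_upwards [hφ.even 0, quasiMeasurePreserving_half.ae
      (quasiMeasurePreserving_coe_neg.ae hdev)] with x h1 h2
    have h3 := m.norm_sq_low ((-(x / 2) : ℝ) : UnitAddCircle)
    have h4 : 2 * Real.pi / 1 * -(x / 2) = -(2 * Real.pi * (x / 2)) := by ring
    rw [h2, AddCircle.toCircle_apply_mk, h4, sub_zero] at h3
    rw [mul_zero] at h1
    rw [h1, norm_mul, norm_mul, mul_pow, mul_pow, h3, Complex.norm_real, norm_inv, inv_pow,
      Real.norm_eq_abs, sq_abs, Real.sq_sqrt (by norm_num), mul_one]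
  have h1 : ‖φ 0‖ = 1 := by
    rw [← (translateₗᵢ 0).norm_map]
    exact (hb.orthonormal_translate 0).1 0
  rw [← Lp.norm_fourier_eq, hzero, norm_zero] at h1
  exact zero_ne_one h1

end HighPass

end WaveletPackets

/-! ### The marginal distribution of a wavelet packet -/

open WaveletPackets in
theorem corollary3p2 (m : QMF) (φ : ℕ → L2R) (hφ : IsPacketSequence m φ)
    (hbasis : IsTranslateBasis φ) (p n : ℕ) (k : ℤ) :
    IsDyadicSpectralMeasure m.S (spectralMeasure m.S) ∧
    HasSum (packetDistribution φ (packet p k (φ n))) 1 ∧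
    (∀ i : Fin p → Fin 2,
      HasSum (fun j : ℤ => packetDistribution φ (packet p k (φ n)) (frequencyIndex n i, j))
        (scalarMeasure m.S (e k) (dyadicInterval i))) ∧
    (∀ r : ℕ, (∀ i : Fin p → Fin 2, r ≠ frequencyIndex n i) →
      HasSum (fun j : ℤ => packetDistribution φ (packet p k (φ n)) (r, j)) 0) := by
  have hE : IsDyadicSpectralMeasure m.S (spectralMeasure m.S) :=
    isDyadicSpectralMeasure_spectralMeasure m.S (exists_isDyadicSpectralMeasure m.S
      (hbasis.norm_S_apply hφ) (hbasis.norm_adjoint_S_sq_add hφ)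
      (hbasis.tendsto_adjoint_S_one_pow hφ))
  refine ⟨hE, ?_, fun i => ?_, fun r hr => ?_⟩
  · simpa [hbasis.norm_packet] using hbasis.hasSum_packetDistribution (packet p k (φ n))
  -- The leading word of `E` is an isometry, so only the norm of its adjoint applied to `e_k`
  -- remains.
  · rw [scalarMeasure, hE.apply_dyadicInterval, mul_apply_eq_comp,
      norm_word_apply m.S (hbasis.norm_S_apply hφ), ← branch_frequencyIndex m.S n i]
    exact hbasis.hasSum_packetDistribution_section hφ p n _ k
  · simpa [branch_eq_zero m.S hr] using hbasis.hasSum_packetDistribution_section hφ p n r k
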